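/- Let $\mathbb{P}$ be the random poset, that is, the Fraïssé limit of the class of all finite partially ordered sets (the countable ultrahomogeneous poset, unique up to isomorphism, whose finite substructures are, up to isomorphism, exactly the finite posets). Give $G=\mathrm{Aut}(\mathbb{P})$ the topology of pointwise convergence on the discrete set $\mathbb{P}$; it is a Polish group. For a standard non-atomic probability space $(X,\mu)$ (for instance $[0,1]$ with Lebesgue measure) let $L_0(G)=L_0(X,\mu;G)$ be the group of $\mu$-equivalence classes of measurable functions $X\to G$, with pointwise multiplication and the topology of convergence in measure: a neighbourhood basis at $h$ is given by the sets $\{g : \mu(\{x : d(g(x),h(x))<\delta\})>1-\varepsilon\}$, $\delta,\varepsilon>0$, where $d$ is a fixed compatible complete metric on $G$. A pair $(g,h)$ of elements of a topological group $H$ cyclically generates $H$ if $\{g^l h g^{-l} : l\in\mathbb{Z}\}$ is dense in $H$; if such a pair exists, $H$ is said to have a cyclically dense conjugacy class. Theorem. For every integer $n\ge 1$ the group $\mathrm{Aut}(\mathbb{P})^n$ (with the product topology) has a cyclically dense conjugacy class, and so does $L_0(\mathrm{Aut}(\mathbb{P}))$. In fact, each of these groups is cyclically generated by a pair $(g,h)$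 which freely generates a free group (of rank two). -/

import Mathlib

open MeasureTheory Topology

universe u

/-! ### Cyclic generation -/

/-- `(g, h)` topologically cyclically generates `G`: the set `{g ^ l * h * g ^ (-l) | l ∈ ℤ}` is
dense in `G`. -/
def CyclicallyGenerates {G : Type*} [Group G] [TopologicalSpace G] (g h : G) : Prop :=
  Dense {k : G | ∃ l : ℤ, k = g ^ l * h * g ^ (-l)}

/-- `G` has a cyclically dense conjugacy class. -/
def HasCyclicallyDenseConjClass (G : Type*) [Group G] [TopologicalSpace G] : Prop :=
  ∃ g h : G, CyclicallyGenerates g h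

/-- `g` and `h` freely generate a free group of rank two: no nontrivial reduced word in `g` and `h`
is the identity. -/
def GenerateFreeGroup {G : Type*} [Group G] (g h : G) : Prop :=
  Function.Injective (FreeGroup.lift ![g, h] : FreeGroup (Fin 2) →* G)

/-! ### The random poset -/

/-- The class of all finite partially ordered sets, as structures in the language with one binary
relation symbol `≤`. -/
def finitePosets : Set (CategoryTheory.Bundled.{u} FirstOrder.Language.order.Structure) :=
  {M | Finite M ∧ M ⊨ FirstOrder.Language.order.partialOrderTheory}

/-- `P` is (a copy of) the random poset: the Fraïssé limit of the class of all finite partially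
ordered sets, that is, a countable ultrahomogeneous poset whose age is this class. -/
def IsRandomPoset (P : Type u) [PartialOrder P] [Countable P] : Prop :=
  letI : FirstOrder.Language.order.Structure P := FirstOrder.Language.orderStructure P
  FirstOrder.Language.IsFraisseLimit finitePosets.{u} P

/-! ### The automorphism group with the topology of pointwise convergence -/

section Aut

variable {P : Type*} [PartialOrder P]

/-- The topology of pointwise convergence on `Aut(P)`, with `P` discrete. -/
instance orderAutTopology : TopologicalSpace (P ≃o P) :=
  TopologicalSpace.induced (fun (g : P ≃o P) (x : P) => g x)
    (@Pi.topologicalSpace P (fun _ => P) (fun _ => ⊥))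

theorem isOpen_orderAut_eval (x y : P) : IsOpen {g : P ≃o P | g x = y} := by
  let _ : TopologicalSpace P := ⊥
  have : DiscreteTopology P := ⟨rfl⟩
  have h : Continuous (fun g : P ≃o P => g x) :=
    (continuous_apply x).comp (continuous_induced_dom (f := fun (g : P ≃o P) (x : P) => g x))
  exact (isOpen_discrete {y}).preimage h

theorem continuous_orderAut_of_eval {Z : Type*} [TopologicalSpace Z] {f : Z → (P ≃o P)}
    (h : ∀ x y : P, IsOpen {z | f z x = y}) : Continuous f := by
  let _ : TopologicalSpace P := ⊥
  have : DiscreteTopology P := ⟨rfl⟩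
  refine continuous_induced_rng.2 (continuous_pi fun x => ?_)
  exact continuous_discrete_rng.2 fun y => h x y

instance orderAut_isTopologicalGroup : IsTopologicalGroup (P ≃o P) where
  continuous_mul := continuous_orderAut_of_eval fun x y => by
    have : {z : (P ≃o P) × (P ≃o P) | (z.1 * z.2) x = y}
        = ⋃ w : P, {z | z.2 x = w} ∩ {z | z.1 w = y} := by
      ext z; simp [RelIso.mul_apply]
    rw [this]
    exact isOpen_iUnion fun w => ((isOpen_orderAut_eval x w).preimage continuous_snd).inter
      ((isOpen_orderAut_eval w y).preimage continuous_fst)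
  continuous_inv := continuous_orderAut_of_eval fun x y => by
    have : {g : P ≃o P | g⁻¹ x = y} = {g | g y = x} := by
      ext g
      exact (OrderIso.symm_apply_eq g).trans eq_comm
    rw [this]
    exact isOpen_orderAut_eval y x

instance orderAut_polishSpace [Countable P] : PolishSpace (P ≃o P) := by
  let _ : TopologicalSpace P := ⊥
  have : DiscreteTopology P := ⟨rfl⟩
  have : PolishSpace P := inferInstance
  have : PolishSpace (P → P) := {}
  have : PolishSpace ((P → P) × (P → P)) := {}
  let F : (P ≃o P) → (P → P) × (P → P) := fun g => (fun x => g x, fun x => g⁻¹ x)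
  have hcoe : Continuous (fun (g : P ≃o P) (x : P) => g x) := continuous_induced_dom
  have hF : Continuous F := hcoe.prodMk (hcoe.comp continuous_inv)
  have hind : IsInducing F :=
    IsInducing.of_comp hF continuous_fst ⟨rfl⟩
  have hinj : Function.Injective F := fun g h e =>
    DFunLike.ext _ _ fun x => congrFun (congrArg Prod.fst e) x
  have hev1 : ∀ x, Continuous fun p : (P → P) × (P → P) => p.1 x := fun x =>
    (continuous_apply x).comp continuous_fst
  have hev2 : ∀ x, Continuous fun p : (P → P) × (P → P) => p.2 x := fun x =>
    (continuous_apply x).comp continuous_snd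
  have hcomp1 : ∀ x y, IsClosed {p : (P → P) × (P → P) | p.1 x = y → p.2 y = x} := fun x y =>
    ((isClopen_discrete {q : P × P | q.1 = y → q.2 = x}).preimage
      ((hev1 x).prodMk (hev2 y))).isClosed
  have hcomp2 : ∀ x y, IsClosed {p : (P → P) × (P → P) | p.2 x = y → p.1 y = x} := fun x y =>
    ((isClopen_discrete {q : P × P | q.1 = y → q.2 = x}).preimage
      ((hev2 x).prodMk (hev1 y))).isClosed
  have hle : ∀ x y, IsClosed {p : (P → P) × (P → P) | p.1 x ≤ p.1 y ↔ x ≤ y} := fun x y =>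
    ((isClopen_discrete {q : P × P | q.1 ≤ q.2 ↔ x ≤ y}).preimage
      ((hev1 x).prodMk (hev1 y))).isClosed
  have hrange : Set.range F = (⋂ x, ⋂ y, {p | p.1 x = y → p.2 y = x}) ∩
      ((⋂ x, ⋂ y, {p | p.2 x = y → p.1 y = x}) ∩
        (⋂ x, ⋂ y, {p | p.1 x ≤ p.1 y ↔ x ≤ y})) := by
    ext p
    simp only [Set.mem_range, Set.mem_inter_iff, Set.mem_iInter, Set.mem_ofPred_eq]
    constructor
    · rintro ⟨g, rfl⟩
      refine ⟨?_, ?_, fun x y => g.le_iff_le⟩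
      · rintro x y rfl
        exact g.symm_apply_apply x
      · rintro x y rfl
        exact g.apply_symm_apply x
    · rintro ⟨h1, h2, h3⟩
      exact ⟨⟨⟨p.1, p.2, fun x => h1 x _ rfl, fun x => h2 x _ rfl⟩, fun {x y} => h3 x y⟩, rfl⟩
  have hclosed : IsClosed (Set.range F) := by
    rw [hrange]
    exact (isClosed_iInter fun x => isClosed_iInter fun y => hcomp1 x y).inter
      ((isClosed_iInter fun x => isClosed_iInter fun y => hcomp2 x y).inter
        (isClosed_iInter fun x => isClosed_iInter fun y => hle x y))
  exact (IsClosedEmbedding.mk ⟨hind, hinj⟩ hclosed).polishSpace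

end Aut

/-! ### The space of measurable functions with the topology of convergence in measure -/

section L0

variable {X : Type*} [MeasurableSpace X]

/-- `L₀(X, μ; Y)`: the `μ`-equivalence classes of measurable functions from `X` to the Polish space
`Y`. (For Polish `Y` with its Borel sets, `μ`-a.e. strongly measurable functions are exactly
the functions that agree `μ`-a.e. with a Borel measurable one.) -/
def LZero (μ : Measure X) (Y : Type*) [TopologicalSpace Y] : Type _ :=
  X →ₘ[μ] Y

/-- The pointwise multiplication of classes of functions. -/
noncomputable instance LZero.instGroup (μ : Measure X) (G : Type*) [TopologicalSpace G] [Group G]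
    [IsTopologicalGroup G] : Group (LZero μ G) :=
  inferInstanceAs (Group (X →ₘ[μ] G))

/-- A function representing the class `f`. -/
noncomputable def LZero.rep {μ : Measure X} {Y : Type*} [TopologicalSpace Y] (f : LZero μ Y) :
    X → Y :=
  AEEqFun.cast (μ := μ) f

/-- The basic neighbourhood
`[h, δ, ε] = {g | μ {x | d (g x) (h x) < δ} > 1 - ε}`, for a metric `d` on `Y`. -/
def LZero.basicNhd {μ : Measure X} {Y : Type*} [TopologicalSpace Y] (d : MetricSpace Y)
    (h : LZero μ Y) (δ ε : ℝ) : Set (LZero μ Y) :=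
  {g | 1 - ε < μ.real {x | d.dist (g.rep x) (h.rep x) < δ}}

/-- A fixed complete metric on `Y` compatible with its topology. -/
@[reducible] noncomputable def compatibleCompleteMetric (Y : Type*) [TopologicalSpace Y] [PolishSpace Y] :
    MetricSpace Y :=
  TopologicalSpace.completelyMetrizableMetric Y

/-- The topology of convergence in measure on `L₀(X, μ; Y)` (`μ` a probability measure, `Y` Polish):
the sets `[h, δ, ε]` with `δ, ε > 0` form a neighbourhood basis at `h`. -/
instance LZero.instTopologicalSpace (μ : Measure X) [IsProbabilityMeasure μ] (Y : Type*)
    [TopologicalSpace Y] [PolishSpace Y] : TopologicalSpace (LZero μ Y) where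
  IsOpen U := ∀ h ∈ U, ∃ δ > 0, ∃ ε > 0, LZero.basicNhd (compatibleCompleteMetric Y) h δ ε ⊆ U
  isOpen_univ := fun _ _ => ⟨1, one_pos, 1, one_pos, Set.subset_univ _⟩
  isOpen_inter := by
    rintro U V hU hV h ⟨hhU, hhV⟩
    obtain ⟨δ₁, hδ₁, ε₁, hε₁, h₁⟩ := hU h hhU
    obtain ⟨δ₂, hδ₂, ε₂, hε₂, h₂⟩ := hV h hhV
    refine ⟨min δ₁ δ₂, lt_min hδ₁ hδ₂, min ε₁ ε₂, lt_min hε₁ hε₂, fun g hg => ⟨h₁ ?_, h₂ ?_⟩⟩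
    · have hle : 1 - ε₁ ≤ 1 - min ε₁ ε₂ := sub_le_sub_left (min_le_left _ _) _
      exact (hle.trans_lt hg).trans_le
        (measureReal_mono (Set.ofPred_subset_ofPred.2 fun x hx => lt_of_lt_of_le hx (min_le_left _ _)))
    · have hle : 1 - ε₂ ≤ 1 - min ε₁ ε₂ := sub_le_sub_left (min_le_right _ _) _
      exact (hle.trans_lt hg).trans_le
        (measureReal_mono (Set.ofPred_subset_ofPred.2 fun x hx => lt_of_lt_of_le hx (min_le_right _ _)))
  isOpen_sUnion := by
    rintro S hS h ⟨U, hUS, hhU⟩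
    obtain ⟨δ, hδ, ε, hε, hsub⟩ := hS U hUS h hhU
    exact ⟨δ, hδ, ε, hε, hsub.trans (Set.subset_sUnion_of_mem hUS)⟩

end L0

/-!
Write `𝔽` for the free group on `a` and `b`. A generic `𝔽`-invariant order on countably many regular
orbits of `𝔽`, in which the powers of `a` move points cofinally upwards, is built by inserting one
orbit at a time into a cut between two finite sets. It is a copy of the random poset `P`, so that
`P` has an automorphism `g` whose powers move every point above every other one, and which together
with a second automorphism `u` freely generates a free group.

Given a sequence in `Aut(P)`, restrict its terms to larger and larger finite sets, repeating each
term infinitely often, and conjugate the restrictions by powers of `g` that stack these sets on top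
of one another. The resulting finite partial isomorphisms have a common extension `h ∈ Aut(P)`, and
each term of the sequence is a limit of conjugates of `h` by powers of `g`. These powers do not
depend on the sequence, and `h` can be chosen to depend continuously on it, so the same encoding
applies coordinatewise in powers of `Aut(P)` and pointwise in `L₀(Aut(P))`; encoding a dense
sequence yields cyclic generation. Since relations of `g` and `h` pass to `g` and any limit of
conjugates of `h` by powers of `g`, the pair `(g, h)` is free as soon as `u` is such a limit.
-/

section CyclicGeneration

variable {G : Type*} [Group G]

/-- The conjugates of `h` by the powers of `g`; the pair `(g, h)` cyclically generates the group
when this set is dense. -/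
def cyclicConjugates (g h : G) : Set G :=
  {k | ∃ l : ℤ, k = g ^ l * h * g ^ (-l)}

theorem GenerateFreeGroup.of_map {G' : Type*} [Group G'] (f : G →* G') {g h : G}
    (hf : GenerateFreeGroup (f g) (f h)) : GenerateFreeGroup g h := by
  have hcomp : FreeGroup.lift ![f g, f h] = f.comp (FreeGroup.lift ![g, h]) := by
    ext i : 1
    fin_cases i <;> simp
  rw [GenerateFreeGroup, hcomp, MonoidHom.coe_comp] at hf
  exact hf.of_comp

theorem freeGroup_lift_zpow_conj (g h : G) (l : ℤ) (w : FreeGroup (Fin 2)) :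
    FreeGroup.lift ![g, g ^ l * h * g ^ (-l)] w = g ^ l * FreeGroup.lift ![g, h] w * g ^ (-l) := by
  have hconj : FreeGroup.lift ![g, g ^ l * h * g ^ (-l)]
      = (MulAut.conj (g ^ l)).toMonoidHom.comp (FreeGroup.lift ![g, h]) := by
    ext i : 1
    fin_cases i
    · simp [-map_zpow, MulAut.conj_apply, (Commute.zpow_self g l).eq]
    · simp [-map_zpow, MulAut.conj_apply]
  rw [hconj]
  simp [-map_zpow, MulAut.conj_apply]

variable [TopologicalSpace G]

theorem cyclicallyGenerates_of_denseRange {ι : Type*} {g h : G} {d : ι → G} (hd : DenseRange d)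
    (hcl : ∀ i, d i ∈ closure (cyclicConjugates g h)) : CyclicallyGenerates g h :=
  dense_closure.1 (hd.mono (Set.range_subset_iff.2 hcl))

variable [IsTopologicalGroup G]

theorem continuous_freeGroup_lift (g : G) (w : FreeGroup (Fin 2)) :
    Continuous fun u : G => FreeGroup.lift ![g, u] w := by
  induction w using FreeGroup.induction_on with
  | C1 => simpa using continuous_const
  | of i =>
    fin_cases i
    · simpa using continuous_const
    · simpa using continuous_id'
  | inv_of i ih => exact ih.inv.congr fun u => (map_inv _ _).symm
  | mul x y hx hy => exact (hx.mul hy).congr fun u => (map_mul _ _ _).symm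

variable [T2Space G]

theorem freeGroup_lift_eq_one_of_mem_closure {g h u : G}
    (hu : u ∈ closure (cyclicConjugates g h)) {w : FreeGroup (Fin 2)}
    (hw : FreeGroup.lift ![g, h] w = 1) : FreeGroup.lift ![g, u] w = 1 := by
  have hclosed : IsClosed {v : G | FreeGroup.lift ![g, v] w = 1} :=
    isClosed_eq (continuous_freeGroup_lift g w) continuous_const
  refine closure_minimal ?_ hclosed hu
  rintro _ ⟨l, rfl⟩
  exact (freeGroup_lift_zpow_conj g h l w).trans (by simp [hw])

theorem GenerateFreeGroup.of_mem_closure {g h u : G} (hfree : GenerateFreeGroup g u)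
    (hu : u ∈ closure (cyclicConjugates g h)) : GenerateFreeGroup g h :=
  (injective_iff_map_eq_one _).2 fun w hw =>
    (injective_iff_map_eq_one _).1 hfree w (freeGroup_lift_eq_one_of_mem_closure hu hw)

theorem CyclicallyGenerates.generateFreeGroup {g h u : G} (hgen : CyclicallyGenerates g h)
    (hfree : GenerateFreeGroup g u) : GenerateFreeGroup g h :=
  hfree.of_mem_closure (hgen u)

end CyclicGeneration

section EncodesSequences

open Filter TopologicalSpace

variable {G : Type*} [Group G] [TopologicalSpace G]

/-- Every sequence in `G` can be encoded in a single element, continuously in the sequence, from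
which conjugation by suitable powers of `g` recovers each term in the limit. The powers do not
depend on the sequence: this is what allows encoding coordinatewise in products and pointwise in
groups of measurable functions. -/
def EncodesSequences (g : G) : Prop :=
  ∃ (H : (ℕ → G) → G) (k : ℕ → ℕ → ℤ), Continuous H ∧
    ∀ d m, Tendsto (fun i => g ^ k m i * H d * g ^ (-k m i)) atTop (𝓝 (d m))

theorem mem_closure_cyclicConjugates {g h u : G} {k : ℕ → ℤ}
    (hk : Tendsto (fun i => g ^ k i * h * g ^ (-k i)) atTop (𝓝 u)) :
    u ∈ closure (cyclicConjugates g h) :=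
  mem_closure_of_tendsto hk (Eventually.of_forall fun i => ⟨k i, rfl⟩)

theorem EncodesSequences.const_pi {g : G} (hg : EncodesSequences g) (ι : Type*) :
    EncodesSequences (Function.const ι g) := by
  obtain ⟨H, k, hH, hk⟩ := hg
  refine ⟨fun d i => H fun m => d m i, k, ?_, fun d m => ?_⟩
  · exact continuous_pi fun i => hH.comp (by fun_prop)
  · exact tendsto_pi_nhds.2 fun i => hk (fun m => d m i) m

theorem EncodesSequences.exists_cyclicallyGenerates [SeparableSpace G] {g : G}
    (hg : EncodesSequences g) : ∃ h, CyclicallyGenerates g h := by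
  obtain ⟨H, k, -, hk⟩ := hg
  exact ⟨H (denseSeq G), cyclicallyGenerates_of_denseRange (denseRange_denseSeq G) fun m =>
    mem_closure_cyclicConjugates (hk (denseSeq G) m)⟩

theorem EncodesSequences.exists_pi_cyclicallyGenerates [IsTopologicalGroup G]
    [SecondCountableTopology G] [T2Space G] {g u : G} (hg : EncodesSequences g)
    (hfree : GenerateFreeGroup g u) (ι : Type*) [Countable ι] [Nonempty ι] :
    ∃ g' h : ι → G, CyclicallyGenerates g' h ∧ GenerateFreeGroup g' h := by
  obtain ⟨h, hgen⟩ := (hg.const_pi ι).exists_cyclicallyGenerates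
  have hconst : GenerateFreeGroup (Function.const ι g) (Function.const ι u) :=
    .of_map (Pi.evalMonoidHom (fun _ => G) (Classical.arbitrary ι)) hfree
  exact ⟨Function.const ι g, h, hgen, hgen.generateFreeGroup hconst⟩

end EncodesSequences

section PartialIso

variable {α β : Type*} [PartialOrder α] [PartialOrder β]

/-- The extension property characterising the random poset: over a finite set `A`, every one-point
type that is consistent with the order is realised by a new point. The type is given by finite sets
`L < U` whose lower and upper closures in `A` are the points below and above the new point. -/
def HasOnePointExtensions (α : Type*) [PartialOrder α] : Prop :=
  ∀ A L U : Finset α, L ⊆ A → U ⊆ A → (∀ l ∈ L, ∀ u ∈ U, l < u) →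
    ∃ x ∉ A, ∀ a ∈ A, (a ≤ x ↔ ∃ l ∈ L, a ≤ l) ∧ (x ≤ a ↔ ∃ u ∈ U, u ≤ a)

theorem HasOnePointExtensions.exists_forall_lt (hα : HasOnePointExtensions α) (A : Finset α) :
    ∃ x, ∀ a ∈ A, a < x := by
  obtain ⟨x, hxA, hx⟩ := hα A A ∅ subset_rfl A.empty_subset (by simp)
  refine ⟨x, fun a ha => lt_of_le_of_ne ((hx a ha).1.2 ⟨a, ha, le_rfl⟩) ?_⟩
  rintro rfl
  exact hxA ha

theorem HasOnePointExtensions.nonempty (hα : HasOnePointExtensions α) : Nonempty α :=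
  ⟨(hα.exists_forall_lt ∅).choose⟩

/-- A set of pairs is (the graph of) a partial isomorphism when it is an isomorphism from its
first projection onto its second one, both with the induced order. -/
def IsPartialIso (S : Set (α × β)) : Prop :=
  ∀ p ∈ S, ∀ q ∈ S, p.1 ≤ q.1 ↔ p.2 ≤ q.2

theorem IsPartialIso.mono {S T : Set (α × β)} (hT : IsPartialIso T) (hST : S ⊆ T) :
    IsPartialIso S :=
  fun p hp q hq => hT p (hST hp) q (hST hq)

theorem IsPartialIso.preimage_swap {S : Set (α × β)} (hS : IsPartialIso S) :
    IsPartialIso (Prod.swap ⁻¹' S) :=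
  fun p hp q hq => (hS p.swap hp q.swap hq).symm

theorem IsPartialIso.lt_iff {S : Set (α × β)} (hS : IsPartialIso S) {p q : α × β}
    (hp : p ∈ S) (hq : q ∈ S) : p.1 < q.1 ↔ p.2 < q.2 := by
  rw [lt_iff_le_not_ge, lt_iff_le_not_ge, hS p hp q hq, hS q hq p hp]

theorem IsPartialIso.eq_iff {S : Set (α × β)} (hS : IsPartialIso S) {p q : α × β}
    (hp : p ∈ S) (hq : q ∈ S) : p.1 = q.1 ↔ p.2 = q.2 := by
  rw [le_antisymm_iff, le_antisymm_iff, hS p hp q hq, hS q hq p hp]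

theorem IsPartialIso.insert_pair {S : Set (α × β)} (hS : IsPartialIso S) {a : α} {b : β}
    (hle : ∀ p ∈ S, p.1 ≤ a ↔ p.2 ≤ b) (hge : ∀ p ∈ S, a ≤ p.1 ↔ b ≤ p.2) :
    IsPartialIso (insert (a, b) S) := by
  rintro p (rfl | hp) q (rfl | hq)
  · simp
  · exact hge q hq
  · exact hle p hp
  · exact hS p hp q hq

theorem IsPartialIso.union_of_lt {S T : Set (α × β)} (hS : IsPartialIso S) (hT : IsPartialIso T)
    (hlt : ∀ p ∈ S, ∀ q ∈ T, p.1 < q.1 ∧ p.2 < q.2) : IsPartialIso (S ∪ T) := by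
  rintro p (hp | hp) q (hq | hq)
  · exact hS p hp q hq
  · exact iff_of_true (hlt p hp q hq).1.le (hlt p hp q hq).2.le
  · exact iff_of_false (hlt q hq p hp).1.not_ge (hlt q hq p hp).2.not_ge
  · exact hT p hp q hq

theorem IsPartialIso.exists_insert (hβ : HasOnePointExtensions β) {S : Finset (α × β)}
    (hS : IsPartialIso (S : Set (α × β))) (a : α) :
    ∃ b, IsPartialIso (insert (a, b) (S : Set (α × β))) := by
  classical
  by_cases ha : ∃ p ∈ S, p.1 = a
  · obtain ⟨⟨_, b⟩, hp, rfl⟩ := ha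
    exact ⟨b, by rwa [Set.insert_eq_of_mem (Finset.mem_coe.2 hp)]⟩
  push Not at ha
  obtain ⟨b, -, hb⟩ := hβ (S.image Prod.snd) ({p ∈ S | p.1 < a}.image Prod.snd)
    ({p ∈ S | a < p.1}.image Prod.snd) (Finset.image_subset_image (Finset.filter_subset _ _))
    (Finset.image_subset_image (Finset.filter_subset _ _)) (by
      simp only [Finset.mem_image, Finset.mem_filter]
      rintro _ ⟨p, ⟨hp, hpa⟩, rfl⟩ _ ⟨q, ⟨hq, haq⟩, rfl⟩
      exact (hS.lt_iff hp hq).1 (hpa.trans haq))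
  refine ⟨b, hS.insert_pair (fun p hp => ?_) fun p hp => ?_⟩
  · rw [(hb p.2 (Finset.mem_image_of_mem _ hp)).1]
    simp only [Finset.exists_mem_image, Finset.mem_filter]
    exact ⟨fun h => ⟨p, ⟨hp, h.lt_of_ne (ha p hp)⟩, le_rfl⟩,
      fun ⟨q, ⟨hq, hqa⟩, hpq⟩ => ((hS p hp q hq).2 hpq).trans hqa.le⟩
  · rw [(hb p.2 (Finset.mem_image_of_mem _ hp)).2]
    simp only [Finset.exists_mem_image, Finset.mem_filter]
    exact ⟨fun h => ⟨p, ⟨hp, h.lt_of_ne (ha p hp).symm⟩, le_rfl⟩,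
      fun ⟨q, ⟨hq, haq⟩, hqp⟩ => haq.le.trans ((hS q hq p hp).2 hqp)⟩

theorem IsPartialIso.exists_extension (hα : HasOnePointExtensions α)
    (hβ : HasOnePointExtensions β) {S : Finset (α × β)}
    (hS : IsPartialIso (S : Set (α × β))) (a : α) (b : β) :
    ∃ T : Finset (α × β), IsPartialIso (T : Set (α × β)) ∧ S ⊆ T ∧
      (∃ y, (a, y) ∈ T) ∧ ∃ x, (x, b) ∈ T := by
  classical
  obtain ⟨y, hy⟩ := hS.exists_insert hβ a
  have hswap : IsPartialIso (((insert (a, y) S).image Prod.swap : Finset (β × α)) :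
      Set (β × α)) := by
    rw [Finset.coe_image, Set.image_swap_eq_preimage_swap, Finset.coe_insert]
    exact hy.preimage_swap
  obtain ⟨x, hx⟩ := hswap.exists_insert hα b
  refine ⟨insert (x, b) (insert (a, y) S), ?_, ?_, ⟨y, by simp⟩, ⟨x, by simp⟩⟩
  · refine hx.preimage_swap.mono ?_
    intro p hp
    simpa [Prod.ext_iff, and_comm] using hp
  · exact fun p hp => by simp [hp]

/-- Adding the pair `(c, c')` first keeps the points below `c` and those below `c'` matched. -/
theorem IsPartialIso.exists_extension_lt (hα : HasOnePointExtensions α)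
    (hβ : HasOnePointExtensions β) {S : Finset (α × β)} (hS : IsPartialIso (S : Set (α × β)))
    {c : α} {c' : β} (hlt : ∀ p ∈ S, p.1 < c ∧ p.2 < c') {a : α} {b : β} (ha : a < c)
    (hb : b < c') :
    ∃ T : Finset (α × β), IsPartialIso (T : Set (α × β)) ∧ (∀ p ∈ T, p.1 < c ∧ p.2 < c') ∧
      S ⊆ T ∧ (∃ y, (a, y) ∈ T) ∧ ∃ x, (x, b) ∈ T := by
  classical
  have hins : IsPartialIso ((insert (c, c') S : Finset (α × β)) : Set (α × β)) := by
    rw [Finset.coe_insert]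
    exact hS.insert_pair (fun p hp => iff_of_true (hlt p hp).1.le (hlt p hp).2.le)
      fun p hp => iff_of_false (hlt p hp).1.not_ge (hlt p hp).2.not_ge
  obtain ⟨T, hT, hST, ⟨y, hy⟩, x, hx⟩ := hins.exists_extension hα hβ a b
  have hcT : (c, c') ∈ T := hST (Finset.mem_insert_self _ _)
  have hTlt : ∀ p ∈ T, p.1 < c ↔ p.2 < c' := fun p hp => hT.lt_iff hp hcT
  refine ⟨{p ∈ T | p.1 < c}, hT.mono (Finset.coe_subset.2 (Finset.filter_subset _ _)),
    fun p hp => ?_, fun p hp => ?_, ⟨y, ?_⟩, x, ?_⟩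
  · obtain ⟨hpT, hpc⟩ := Finset.mem_filter.1 hp
    exact ⟨hpc, (hTlt p hpT).1 hpc⟩
  · exact Finset.mem_filter.2 ⟨hST (Finset.mem_insert_of_mem hp), (hlt p hp).1⟩
  · exact Finset.mem_filter.2 ⟨hy, ha⟩
  · exact Finset.mem_filter.2 ⟨hx, (hTlt _ hx).2 hb⟩

theorem IsPartialIso.exists_orderIso {S : Set (α × β)} (hS : IsPartialIso S)
    (hdom : ∀ a, ∃ b, (a, b) ∈ S) (hran : ∀ b, ∃ a, (a, b) ∈ S) :
    ∃ e : α ≃o β, ∀ p ∈ S, e p.1 = p.2 := by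
  choose f hf using hdom
  choose g hg using hran
  refine ⟨⟨⟨f, g, fun a => ?_, fun b => ?_⟩, fun {a a'} => ?_⟩, fun p hp => ?_⟩
  · exact (hS.eq_iff (hg (f a)) (hf a)).2 rfl
  · exact (hS.eq_iff (hf (g b)) (hg b)).1 rfl
  · exact (hS _ (hf a) _ (hf a')).symm
  · exact (hS.eq_iff (hf p.1) hp).1 rfl

theorem exists_orderIso_of_monotone {S : ℕ → Finset (α × β)} (hmono : Monotone S)
    (hS : ∀ n, IsPartialIso (S n : Set (α × β))) (hdom : ∀ a, ∃ n b, (a, b) ∈ S n)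
    (hran : ∀ b, ∃ n a, (a, b) ∈ S n) :
    ∃ e : α ≃o β, ∀ n, ∀ p ∈ S n, e p.1 = p.2 := by
  have hunion : IsPartialIso {p | ∃ n, p ∈ S n} := by
    rintro p ⟨m, hp⟩ q ⟨n, hq⟩
    exact hS (max m n) p (hmono (le_max_left m n) hp) q (hmono (le_max_right m n) hq)
  obtain ⟨e, he⟩ := hunion.exists_orderIso (fun a => exists_comm.1 (hdom a))
    fun b => exists_comm.1 (hran b)
  exact ⟨e, fun n p hp => he p ⟨n, hp⟩⟩

theorem HasOnePointExtensions.nonempty_orderIso [Countable α] [Countable β]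
    (hα : HasOnePointExtensions α) (hβ : HasOnePointExtensions β) : Nonempty (α ≃o β) := by
  have := hα.nonempty
  have := hβ.nonempty
  obtain ⟨e, he⟩ := exists_surjective_nat α
  obtain ⟨f, hf⟩ := exists_surjective_nat β
  choose ext hiso hsub hdom hran using
    fun (S : {S : Finset (α × β) // IsPartialIso (S : Set (α × β))}) (n : ℕ) =>
      S.2.exists_extension hα hβ (e n) (f n)
  let S : ℕ → {S : Finset (α × β) // IsPartialIso (S : Set (α × β))} :=
    Nat.rec ⟨∅, by simp [IsPartialIso]⟩ fun n T => ⟨ext T n, hiso T n⟩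
  obtain ⟨i, -⟩ := exists_orderIso_of_monotone (S := fun n => (S n).1)
    (monotone_nat_of_le_succ fun n => hsub (S n) n) (fun n => (S n).2)
    (he.forall.2 fun n => ⟨n + 1, hdom (S n) n⟩) (hf.forall.2 fun n => ⟨n + 1, hran (S n) n⟩)
  exact ⟨i⟩

end PartialIso

section PosetCut

variable {α : Type*} [PartialOrder α]

/-- A cut of a poset: the points that are to lie below, respectively above, a given point of an
extension. The two sets may leave out points of the poset and may be empty, and they meet exactly
when the cut is realised in the poset itself. -/
structure PosetCut (α : Type*) [PartialOrder α] where
  lower : LowerSet α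
  upper : UpperSet α
  le_of_mem : ∀ a ∈ lower, ∀ b ∈ upper, a ≤ b

namespace PosetCut

/-- The cut of a point placed freely between `L` and `U`. -/
def between (L U : Set α) (hLU : ∀ l ∈ L, ∀ u ∈ U, l ≤ u) : PosetCut α where
  lower := lowerClosure L
  upper := upperClosure U
  le_of_mem := fun _ ⟨l, hl, hal⟩ _ ⟨u, hu, hub⟩ => hal.trans ((hLU l hl u hu).trans hub)

/-- The point `a` of the poset lies in the cut `κ`. -/
def IsRealizedBy (κ : PosetCut α) (a : α) : Prop :=
  a ∈ κ.lower ∧ a ∈ κ.upper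

theorem IsRealizedBy.eq {κ : PosetCut α} {a b : α} (ha : κ.IsRealizedBy a)
    (hb : κ.IsRealizedBy b) : a = b :=
  (κ.le_of_mem a ha.1 b hb.2).antisymm (κ.le_of_mem b hb.1 a ha.2)

theorem isRealizedBy_between_singleton (a : α) :
    (between {a} {a} (by simp)).IsRealizedBy a :=
  ⟨⟨a, rfl, le_rfl⟩, a, rfl, le_rfl⟩

theorem not_isRealizedBy_between {L U : Set α} (hLU : ∀ l ∈ L, ∀ u ∈ U, l < u) (a : α) :
    ¬ (between L U fun l hl u hu => (hLU l hl u hu).le).IsRealizedBy a := by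
  rintro ⟨⟨l, hl, hal⟩, u, hu, hua⟩
  exact (hLU l hl u hu).not_ge (hua.trans hal)

variable {W : Type*} (c : W → PosetCut α)
  (hc : ∀ a x y, (c x).IsRealizedBy a → (c y).IsRealizedBy a → x = y)

/-- The order on a set of points with prescribed cuts in `α` generated by these cuts: distinct
points are only related through an element of `α`. No two of the points may realise the same
element of `α`. -/
@[reducible] def order : PartialOrder W where
  le x y := x = y ∨ ∃ a, a ∈ (c x).upper ∧ a ∈ (c y).lower
  le_refl x := Or.inl rfl
  le_trans := by
    rintro x y z (rfl | ⟨a, hax, hay⟩) (rfl | ⟨b, hby, hbz⟩)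
    · exact Or.inl rfl
    · exact Or.inr ⟨b, hby, hbz⟩
    · exact Or.inr ⟨a, hax, hay⟩
    · exact Or.inr ⟨a, hax, (c z).lower.lower ((c y).le_of_mem a hay b hby) hbz⟩
  le_antisymm := by
    rintro x y (rfl | ⟨a, hax, hay⟩) (h | ⟨b, hby, hbx⟩)
    · rfl
    · rfl
    · exact h.symm
    · obtain rfl : a = b := ((c y).le_of_mem a hay b hby).antisymm ((c x).le_of_mem b hbx a hax)
      exact hc a x y ⟨hbx, hax⟩ ⟨hay, hby⟩

variable {c}

theorem order_le_iff_of_left {a : α} {x y : W} (hx : (c x).IsRealizedBy a) :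
    (order c hc).le x y ↔ a ∈ (c y).lower := by
  constructor
  · rintro (rfl | ⟨b, hbx, hby⟩)
    · exact hx.1
    · exact (c y).lower.lower ((c x).le_of_mem a hx.1 b hbx) hby
  · exact fun ha => Or.inr ⟨a, hx.2, ha⟩

theorem order_le_iff_of_right {b : α} {x y : W} (hy : (c y).IsRealizedBy b) :
    (order c hc).le x y ↔ b ∈ (c x).upper := by
  constructor
  · rintro (rfl | ⟨a, hax, hay⟩)
    · exact hy.2
    · exact (c x).upper.upper ((c y).le_of_mem a hay b hy.2) hax
  · exact fun hb => Or.inr ⟨b, hb, hy.1⟩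

theorem order_lt_of_lt {a b : α} {x y : W} (ha : a ∈ (c x).upper) (hb : b ∈ (c y).lower)
    (hab : a < b) : (order c hc).lt x y := by
  refine ((order c hc).lt_iff_le_not_ge x y).2
    ⟨Or.inr ⟨a, ha, (c y).lower.lower hab.le hb⟩, ?_⟩
  rintro (rfl | ⟨d, hdy, hdx⟩)
  · exact hab.not_ge ((c y).le_of_mem b hb a ha)
  · exact hab.not_ge (((c y).le_of_mem b hb d hdy).trans ((c x).le_of_mem d hdx a ha))

theorem exists_finite_extension {α : Type u} [PartialOrder α] [Finite α] (κ : PosetCut α)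
    (hκ : ∀ a, ¬ κ.IsRealizedBy a) :
    ∃ (W : Type u) (_ : Finite W) (_ : PartialOrder W) (j : α ↪o W) (x : W),
      ∀ a, (j a ≤ x ↔ a ∈ κ.lower) ∧ (x ≤ j a ↔ a ∈ κ.upper) := by
  let c : Option α → PosetCut α := fun x => x.elim κ fun a => between {a} {a} (by simp)
  have hsome : ∀ a, (c (some a)).IsRealizedBy a := isRealizedBy_between_singleton
  have hc : ∀ a x y, (c x).IsRealizedBy a → (c y).IsRealizedBy a → x = y := by
    rintro a (_ | b) (_ | b') hx hy
    · rfl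
    · exact absurd hx (hκ a)
    · exact absurd hy (hκ a)
    · rw [(hsome b).eq hx, (hsome b').eq hy]
  have hle : ∀ {a b : α}, (order c hc).le (some a) (some b) ↔ a ≤ b := fun {a b} =>
    (order_le_iff_of_left hc (hsome a)).trans ⟨fun ⟨_, h, hab⟩ => h ▸ hab, fun hab => ⟨b, rfl, hab⟩⟩
  exact ⟨Option α, inferInstance, order c hc, ⟨⟨some, Option.some_injective α⟩, hle⟩, none,
    fun a => ⟨order_le_iff_of_left hc (hsome a), order_le_iff_of_right hc (hsome a)⟩⟩

end PosetCut

end PosetCut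

section RandomPoset

open FirstOrder FirstOrder.Language

theorem IsRandomPoset.exists_orderEmbedding {P : Type u} [PartialOrder P] [Countable P]
    (hP : IsRandomPoset P) {S : Finset P} {W : Type u} [PartialOrder W] [Finite W] (j : S ↪o W) :
    ∃ f : W ↪o P, ∀ a, f (j a) = a := by
  let _ : Language.order.Structure P := orderStructure P
  let _ : Language.order.Structure W := orderStructure W
  let _ : Language.order.Structure S := orderStructure S
  have : Language.order.OrderedStructure P := ⟨fun _ => Iff.rfl⟩
  have : Language.order.OrderedStructure W := ⟨fun _ => Iff.rfl⟩
  have : Language.order.OrderedStructure S := ⟨fun _ => Iff.rfl⟩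
  have hlim : IsFraisseLimit finitePosets.{u} P := hP
  have hW : (⟨W, inferInstance⟩ : CategoryTheory.Bundled.{u} Language.order.Structure) ∈
      finitePosets.{u} :=
    ⟨inferInstanceAs (Finite W), model_partialOrder (M := W)⟩
  rw [← hlim.age] at hW
  have : Nonempty (Language.order.Embedding W P) := hW.2
  obtain ⟨f, hf⟩ := hlim.ultrahomogeneous.extend_embedding Structure.FG.of_finite
    (StrongHomClass.toEmbedding (OrderEmbedding.subtype (· ∈ S))) (StrongHomClass.toEmbedding j)
  refine ⟨⟨f.toEmbedding, fun {x y} => ?_⟩, fun a => (DFunLike.congr_fun hf a).symm⟩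
  have hrel := f.map_rel' leSymb ![x, y]
  rwa [relMap_leSymb, relMap_leSymb] at hrel

theorem IsRandomPoset.hasOnePointExtensions {P : Type u} [PartialOrder P] [Countable P]
    (hP : IsRandomPoset P) : HasOnePointExtensions P := by
  intro A L U hLA hUA hLU
  have hlt : ∀ l ∈ (Subtype.val ⁻¹' L : Set A), ∀ u ∈ (Subtype.val ⁻¹' U : Set A), l < u :=
    fun l hl u hu => hLU l hl u hu
  let κ : PosetCut A := .between _ _ fun l hl u hu => (hlt l hl u hu).le
  have hκ : ∀ a, ¬ κ.IsRealizedBy a := PosetCut.not_isRealizedBy_between hlt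
  obtain ⟨W, _, _, j, x, hx⟩ := κ.exists_finite_extension hκ
  obtain ⟨f, hf⟩ := hP.exists_orderEmbedding j
  refine ⟨f x, fun hxA => ?_, fun a ha => ?_⟩
  · have hxj : x = j ⟨f x, hxA⟩ := f.injective (hf ⟨f x, hxA⟩).symm
    exact hκ _ ⟨(hx _).1.1 hxj.ge, (hx _).2.1 hxj.le⟩
  · have hfa : f (j ⟨a, ha⟩) = a := hf _
    constructor
    · rw [← hfa, f.le_iff_le, (hx _).1, hfa]
      exact ⟨fun ⟨l, hl, hal⟩ => ⟨l, hl, hal⟩, fun ⟨l, hl, hal⟩ => ⟨⟨l, hLA hl⟩, hl, hal⟩⟩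
    · rw [← hfa, f.le_iff_le, (hx _).2, hfa]
      exact ⟨fun ⟨u, hu, hua⟩ => ⟨u, hu, hua⟩, fun ⟨u, hu, hua⟩ => ⟨⟨u, hUA hu⟩, hu, hua⟩⟩

end RandomPoset

section InvariantOrder

open Filter
open scoped Pointwise

variable {Γ : Type*} [Group Γ]

/-- The disjoint union of countably many regular orbits of `Γ`; the first component of a point is
the index of its orbit. -/
abbrev RegularOrbits (Γ : Type*) : Type _ :=
  Σ _ : ℕ, Γ

/-- The stages of the construction of a `Γ`-invariant order: the orbits of index at most `n` have
been ordered, so that the powers of `a` move points cofinally upwards, while the points of all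
other orbits are still incomparable to everything else. -/
structure IsStage (a : Γ) (n : ℕ) (o : PartialOrder (RegularOrbits Γ)) : Prop where
  covariant : CovariantClass Γ (RegularOrbits Γ) HSMul.hSMul o.le
  eq_or_fst_le : ∀ x y, o.le x y → x = y ∨ x.1 ≤ n ∧ y.1 ≤ n
  eventually_lt : ∀ x y, x.1 ≤ n → y.1 ≤ n → ∀ᶠ k : ℕ in atTop, o.lt x (a ^ k • y)

theorem exists_isStage_zero {M : Type*} [CommGroup M] [LinearOrder M] [IsOrderedMonoid M]
    [MulArchimedean M] (φ : Γ →* M) {a : Γ} (ha : 1 < φ a) : ∃ o, IsStage a 0 o := by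
  let r : RegularOrbits Γ → RegularOrbits Γ → Prop := fun x y =>
    (x.1 = 0 ∧ y.1 = 0) ∧ φ x.2 < φ y.2
  have : IsStrictOrder (RegularOrbits Γ) r :=
    { irrefl := fun x hx => lt_irrefl _ hx.2
      trans := fun x y z hxy hyz => ⟨⟨hxy.1.1, hyz.1.2⟩, hxy.2.trans hyz.2⟩ }
  refine ⟨partialOrderOfSO r, ⟨?_⟩, ?_, fun x y hx hy => ?_⟩
  · rintro γ x y (rfl | ⟨h0, hlt⟩)
    · exact Or.inl rfl
    · refine Or.inr ⟨h0, ?_⟩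
      change φ (γ * x.2) < φ (γ * y.2)
      simpa only [map_mul, mul_lt_mul_iff_left] using hlt
  · rintro x y (rfl | ⟨h0, -⟩)
    · exact Or.inl rfl
    · exact Or.inr ⟨h0.1.le, h0.2.le⟩
  · obtain ⟨N, hN⟩ := MulArchimedean.arch (φ x.2 / φ y.2) ha
    filter_upwards [eventually_gt_atTop N] with k hk
    refine ⟨⟨Nat.le_zero.1 hx, Nat.le_zero.1 hy⟩, ?_⟩
    change φ x.2 < φ (a ^ k * y.2)
    rw [map_mul, map_pow, ← div_lt_iff_lt_mul]
    exact hN.trans_lt (pow_lt_pow_right' ha hk)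

/-- The points determining the lower (or upper) half of the cut in which the stage `n + 1` places
`x`: a new point `⟨n + 1, β⟩` is placed above (or below) the translate `β • L`, an old one at
itself. -/
def cutGenerators (n : ℕ) (L : Set (RegularOrbits Γ)) (x : RegularOrbits Γ) :
    Set (RegularOrbits Γ) :=
  {y | x.1 = n + 1 ∧ y ∈ x.2 • L ∨ x.1 ≠ n + 1 ∧ y = x}

section CutGenerators

variable {n : ℕ} {L : Set (RegularOrbits Γ)} {x y : RegularOrbits Γ}

theorem mem_cutGenerators_of_eq (hx : x.1 = n + 1) : y ∈ cutGenerators n L x ↔ y ∈ x.2 • L := by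
  simp [cutGenerators, hx]

theorem mem_cutGenerators_of_ne (hx : x.1 ≠ n + 1) : y ∈ cutGenerators n L x ↔ y = x := by
  simp [cutGenerators, hx]

theorem smul_mem_cutGenerators (γ : Γ) (hy : y ∈ cutGenerators n L x) :
    γ • y ∈ cutGenerators n L (γ • x) := by
  refine hy.imp (And.imp_right fun h => ?_) (And.imp_right (congrArg (γ • ·)))
  change γ • y ∈ (γ * x.2) • L
  rw [mul_smul]
  exact Set.smul_mem_smul_set h

theorem fst_le_of_mem_cutGenerators (hL : ∀ l ∈ L, l.1 ≤ n) (hx : x.1 = n + 1)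
    (hy : y ∈ cutGenerators n L x) : y.1 ≤ n := by
  obtain ⟨l, hl, rfl⟩ := (mem_cutGenerators_of_eq hx).1 hy
  exact hL l hl

theorem exists_mem_cutGenerators (hL : ∀ l ∈ L, l.1 ≤ n) (hne : L.Nonempty) (hx : x.1 ≤ n + 1) :
    ∃ y ∈ cutGenerators n L x, y.1 ≤ n := by
  by_cases hxn : x.1 = n + 1
  · obtain ⟨y, hy⟩ := hne.smul_set (a := x.2)
    have hyL := (mem_cutGenerators_of_eq hxn).2 hy
    exact ⟨y, hyL, fst_le_of_mem_cutGenerators hL hxn hyL⟩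
  · exact ⟨x, (mem_cutGenerators_of_ne hxn).2 rfl, by omega⟩

end CutGenerators

namespace IsStage

section NextOrder

variable {a : Γ} {n : ℕ} [o : PartialOrder (RegularOrbits Γ)] {L U : Set (RegularOrbits Γ)}
  {x y : RegularOrbits Γ}

theorem smul_strictMono (ho : IsStage a n o) (γ : Γ) :
    StrictMono fun x : RegularOrbits Γ => γ • x :=
  have := ho.covariant
  (smul_mono_right γ).strictMono_of_injective (MulAction.injective γ)

theorem lt_of_mem_cutGenerators (ho : IsStage a n o) (hLU : ∀ l ∈ L, ∀ u ∈ U, l < u)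
    (hx : x.1 = n + 1) : ∀ l ∈ cutGenerators n L x, ∀ u ∈ cutGenerators n U x, l < u := by
  intro l hl u hu
  obtain ⟨l, hlL, rfl⟩ := (mem_cutGenerators_of_eq hx).1 hl
  obtain ⟨u, huU, rfl⟩ := (mem_cutGenerators_of_eq hx).1 hu
  exact ho.smul_strictMono x.2 (hLU l hlL u huU)

theorem le_of_mem_cutGenerators (ho : IsStage a n o) (hLU : ∀ l ∈ L, ∀ u ∈ U, l < u)
    (x : RegularOrbits Γ) : ∀ l ∈ cutGenerators n L x, ∀ u ∈ cutGenerators n U x, l ≤ u := by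
  intro l hl u hu
  by_cases hx : x.1 = n + 1
  · exact (ho.lt_of_mem_cutGenerators hLU hx l hl u hu).le
  · rw [(mem_cutGenerators_of_ne hx).1 hl, (mem_cutGenerators_of_ne hx).1 hu]

/-- The cut in which the stage `n + 1` places the point `x`. -/
def nextCut (ho : IsStage a n o) (hLU : ∀ l ∈ L, ∀ u ∈ U, l < u) (x : RegularOrbits Γ) :
    PosetCut (RegularOrbits Γ) :=
  .between (cutGenerators n L x) (cutGenerators n U x) (ho.le_of_mem_cutGenerators hLU x)

variable (ho : IsStage a n o) (hLU : ∀ l ∈ L, ∀ u ∈ U, l < u)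

theorem isRealizedBy_nextCut_iff :
    (ho.nextCut hLU x).IsRealizedBy y ↔ y = x ∧ x.1 ≠ n + 1 := by
  by_cases hx : x.1 = n + 1
  · exact iff_of_false (PosetCut.not_isRealizedBy_between (ho.lt_of_mem_cutGenerators hLU hx) y)
      fun h => h.2 hx
  · have hxx : (ho.nextCut hLU x).IsRealizedBy x :=
      ⟨⟨x, (mem_cutGenerators_of_ne hx).2 rfl, le_rfl⟩, x, (mem_cutGenerators_of_ne hx).2 rfl,
        le_rfl⟩
    exact ⟨fun hy => ⟨hy.eq hxx, hx⟩, fun hy => hy.1 ▸ hxx⟩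

/-- The order of the stage `n + 1`. -/
@[reducible] def nextOrder : PartialOrder (RegularOrbits Γ) :=
  PosetCut.order (ho.nextCut hLU) fun _ _ _ hx hy =>
    ((ho.isRealizedBy_nextCut_iff hLU).1 hx).1.symm.trans
      ((ho.isRealizedBy_nextCut_iff hLU).1 hy).1

theorem covariant_nextOrder :
    CovariantClass Γ (RegularOrbits Γ) HSMul.hSMul (ho.nextOrder hLU).le := by
  refine ⟨fun γ x y => ?_⟩
  rintro (rfl | ⟨b, ⟨u, hu, hub⟩, l, hl, hbl⟩)
  · exact Or.inl rfl
  · have hmono := (ho.smul_strictMono γ).monotone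
    exact Or.inr ⟨γ • b, ⟨γ • u, smul_mem_cutGenerators γ hu, hmono hub⟩,
      γ • l, smul_mem_cutGenerators γ hl, hmono hbl⟩

theorem eq_or_fst_le_nextOrder (hL : ∀ l ∈ L, l.1 ≤ n) (hU : ∀ u ∈ U, u.1 ≤ n)
    (hxy : (ho.nextOrder hLU).le x y) : x = y ∨ x.1 ≤ n + 1 ∧ y.1 ≤ n + 1 := by
  obtain rfl | ⟨b, ⟨u, hu, hub⟩, l, hl, hbl⟩ := hxy
  · exact Or.inl rfl
  have hul := ho.eq_or_fst_le u l (hub.trans hbl)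
  by_cases hx : x.1 = n + 1 <;> by_cases hy : y.1 = n + 1
  · exact Or.inr ⟨hx.le, hy.le⟩
  · have hun := fst_le_of_mem_cutGenerators hU hx hu
    obtain rfl := (mem_cutGenerators_of_ne hy).1 hl
    grind
  · have hln := fst_le_of_mem_cutGenerators hL hy hl
    obtain rfl := (mem_cutGenerators_of_ne hx).1 hu
    grind
  · obtain rfl := (mem_cutGenerators_of_ne hx).1 hu
    obtain rfl := (mem_cutGenerators_of_ne hy).1 hl
    grind

theorem eventually_lt_nextOrder (hL : ∀ l ∈ L, l.1 ≤ n) (hU : ∀ u ∈ U, u.1 ≤ n)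
    (hLne : L.Nonempty) (hUne : U.Nonempty) (hx : x.1 ≤ n + 1) (hy : y.1 ≤ n + 1) :
    ∀ᶠ k : ℕ in atTop, (ho.nextOrder hLU).lt x (a ^ k • y) := by
  obtain ⟨u, hu, hun⟩ := exists_mem_cutGenerators hU hUne hx
  obtain ⟨l, hl, hln⟩ := exists_mem_cutGenerators hL hLne hy
  filter_upwards [ho.eventually_lt u l hun hln] with k hk
  exact PosetCut.order_lt_of_lt _ ⟨u, hu, le_rfl⟩ ⟨_, smul_mem_cutGenerators (a ^ k) hl, le_rfl⟩ hk

theorem nextOrder_le_iff_of_left (hx : x.1 ≠ n + 1) :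
    (ho.nextOrder hLU).le x y ↔ ∃ l ∈ cutGenerators n L y, x ≤ l :=
  PosetCut.order_le_iff_of_left _ ((ho.isRealizedBy_nextCut_iff hLU).2 ⟨rfl, hx⟩)

theorem nextOrder_le_iff_of_right (hy : y.1 ≠ n + 1) :
    (ho.nextOrder hLU).le x y ↔ ∃ u ∈ cutGenerators n U x, u ≤ y :=
  PosetCut.order_le_iff_of_right _ ((ho.isRealizedBy_nextCut_iff hLU).2 ⟨rfl, hy⟩)

theorem nextOrder_le_iff (hx : x.1 ≠ n + 1) (hy : y.1 ≠ n + 1) :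
    (ho.nextOrder hLU).le x y ↔ x ≤ y := by
  simp [ho.nextOrder_le_iff_of_left hLU hx, mem_cutGenerators_of_ne hy]

end NextOrder

variable {a : Γ} {n : ℕ} {o : PartialOrder (RegularOrbits Γ)}

/-- The finite one-point types realised in the construction are given by non-empty sets of points
of the orbits ordered so far; every other type is obtained by adding strict bounds to these sets. -/
structure IsAdmissible (n : ℕ) (o : PartialOrder (RegularOrbits Γ)) (L U : Set (RegularOrbits Γ)) :
    Prop where
  nonempty_left : L.Nonempty
  nonempty_right : U.Nonempty
  fst_le_left : ∀ l ∈ L, l.1 ≤ n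
  fst_le_right : ∀ u ∈ U, u.1 ≤ n
  lt : ∀ l ∈ L, ∀ u ∈ U, o.lt l u

theorem exists_next_of_isAdmissible (ho : IsStage a n o) {L U : Set (RegularOrbits Γ)}
    (h : IsAdmissible n o L U) :
    ∃ o', IsStage a (n + 1) o' ∧ (∀ x y, x.1 ≤ n → y.1 ≤ n → (o'.le x y ↔ o.le x y)) ∧
      ∃ z : RegularOrbits Γ, z.1 = n + 1 ∧ ∀ x, x.1 ≤ n →
        (o'.le x z ↔ ∃ l ∈ L, o.le x l) ∧ (o'.le z x ↔ ∃ u ∈ U, o.le u x) := by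
  have hne : ∀ {x : RegularOrbits Γ}, x.1 ≤ n → x.1 ≠ n + 1 := fun hx => by omega
  let z : RegularOrbits Γ := ⟨n + 1, 1⟩
  have hz : ∀ K : Set (RegularOrbits Γ), ∀ y, y ∈ cutGenerators n K z ↔ y ∈ K := fun K y => by
    rw [mem_cutGenerators_of_eq rfl, one_smul]
  refine ⟨ho.nextOrder h.lt, ⟨ho.covariant_nextOrder h.lt,
      fun _ _ => ho.eq_or_fst_le_nextOrder h.lt h.fst_le_left h.fst_le_right,
      fun _ _ => ho.eventually_lt_nextOrder h.lt h.fst_le_left h.fst_le_right h.nonempty_left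
        h.nonempty_right⟩,
    fun x y hx hy => ho.nextOrder_le_iff h.lt (hne hx) (hne hy), z, rfl,
    fun x hx => ?_⟩
  simp only [ho.nextOrder_le_iff_of_left h.lt (hne hx), ho.nextOrder_le_iff_of_right h.lt (hne hx),
    hz, true_and]

theorem exists_next (ho : IsStage a n o) (L U : Set (RegularOrbits Γ)) :
    ∃ o', IsStage a (n + 1) o' ∧ (∀ x y, x.1 ≤ n → y.1 ≤ n → (o'.le x y ↔ o.le x y)) ∧
      (IsAdmissible n o L U → ∃ z : RegularOrbits Γ, z.1 = n + 1 ∧ ∀ x, x.1 ≤ n →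
        (o'.le x z ↔ ∃ l ∈ L, o.le x l) ∧ (o'.le z x ↔ ∃ u ∈ U, o.le u x)) := by
  by_cases h : IsAdmissible n o L U
  · obtain ⟨o', ho', hagree, hz⟩ := ho.exists_next_of_isAdmissible h
    exact ⟨o', ho', hagree, fun _ => hz⟩
  · let x : RegularOrbits Γ := ⟨0, 1⟩
    obtain ⟨k, hk⟩ := (ho.eventually_lt x x n.zero_le n.zero_le).exists
    have hadm : IsAdmissible n o {x} {a ^ k • x} :=
      ⟨Set.singleton_nonempty _, Set.singleton_nonempty _, by simp [x], by simp [x],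
        by simpa using hk⟩
    obtain ⟨o', ho', hagree, -⟩ := ho.exists_next_of_isAdmissible hadm
    exact ⟨o', ho', hagree, fun h' => absurd h' h⟩

end IsStage

theorem exists_seq_frequently_eq (T : Type*) [Countable T] [Nonempty T] :
    ∃ f : ℕ → T, ∀ t N, ∃ n, N ≤ n ∧ f n = t := by
  obtain ⟨e, he⟩ := exists_surjective_nat T
  exact ⟨fun n => e n.unpair.1,
    he.forall.2 fun j N => ⟨Nat.pair j N, Nat.right_le_pair j N, by simp⟩⟩

theorem exists_partialOrder_limit {V : Type*} (r : V → ℕ) (o : ℕ → PartialOrder V)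
    (ho : ∀ n x y, r x ≤ n → r y ≤ n → ((o (n + 1)).le x y ↔ (o n).le x y)) :
    ∃ o' : PartialOrder V, ∀ n x y, r x ≤ n → r y ≤ n → (o'.le x y ↔ (o n).le x y) := by
  have hstable : ∀ n x y, r x ≤ n → r y ≤ n →
      ((o n).le x y ↔ (o (max (r x) (r y))).le x y) := by
    intro n x y hx hy
    induction n, max_le hx hy using Nat.le_induction with
    | base => rfl
    | succ n hn ih =>
      have hxn := (le_max_left _ _).trans hn
      have hyn := (le_max_right _ _).trans hn
      exact (ho n x y hxn hyn).trans (ih hxn hyn)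
  let o' : PartialOrder V :=
    { le := fun x y => (o (max (r x) (r y))).le x y
      le_refl := fun x => (o _).le_refl x
      le_trans := fun x y z hxy hyz => by
        let n := max (r x) (max (r y) (r z))
        rw [← hstable n _ _ (by omega) (by omega)] at hxy hyz ⊢
        exact (o n).le_trans x y z hxy hyz
      le_antisymm := fun x y hxy hyx => by
        rw [max_comm] at hyx
        exact (o _).le_antisymm x y hxy hyx }
  exact ⟨o', fun n x y hx hy => (hstable n x y hx hy).symm⟩

theorem HasOnePointExtensions.of_nonempty {α : Type*} [PartialOrder α]
    (hbelow : ∀ A : Finset α, ∃ m, ∀ a ∈ A, m < a) (habove : ∀ A : Finset α, ∃ m, ∀ a ∈ A, a < m)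
    (hext : ∀ A L U : Finset α, L ⊆ A → U ⊆ A → L.Nonempty → U.Nonempty →
      (∀ l ∈ L, ∀ u ∈ U, l < u) →
      ∃ x ∉ A, ∀ a ∈ A, (a ≤ x ↔ ∃ l ∈ L, a ≤ l) ∧ (x ≤ a ↔ ∃ u ∈ U, u ≤ a)) :
    HasOnePointExtensions α := by
  classical
  intro A L U hLA hUA hLU
  obtain ⟨t, ht⟩ := habove A
  obtain ⟨b, hb⟩ := hbelow (insert t A)
  rw [Finset.forall_mem_insert] at hb
  obtain ⟨hbt, hb⟩ := hb
  obtain ⟨x, hxA, hx⟩ := hext (insert b (insert t A)) (insert b L) (insert t U)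
    (Finset.insert_subset_insert _ (hLA.trans (Finset.subset_insert _ _)))
    ((Finset.insert_subset_insert _ hUA).trans (Finset.subset_insert _ _))
    (Finset.insert_nonempty _ _) (Finset.insert_nonempty _ _) (by
      simp only [Finset.forall_mem_insert]
      exact ⟨⟨hbt, fun u hu => hb u (hUA hu)⟩, fun l hl => ⟨ht l (hLA hl), hLU l hl⟩⟩)
  refine ⟨x, fun h => hxA (by simp [h]), fun a ha => ?_⟩
  have hxa := hx a (by simp [ha])
  simpa only [Finset.exists_mem_insert, (hb a ha).not_ge, (ht a ha).not_ge, false_or] using hxa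

theorem exists_isStage_seq [Countable Γ] {a : Γ} {o₀ : PartialOrder (RegularOrbits Γ)}
    (ho₀ : IsStage a 0 o₀) :
    ∃ o : ℕ → PartialOrder (RegularOrbits Γ), (∀ n, IsStage a n (o n)) ∧
      (∀ n x y, x.1 ≤ n → y.1 ≤ n → ((o (n + 1)).le x y ↔ (o n).le x y)) ∧
      ∀ (L U : Finset (RegularOrbits Γ)) (N : ℕ), ∃ n, N ≤ n ∧
        (IsStage.IsAdmissible n (o n) L U → ∃ z : RegularOrbits Γ, z.1 = n + 1 ∧ ∀ x, x.1 ≤ n →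
          ((o (n + 1)).le x z ↔ ∃ l ∈ L, (o n).le x l) ∧
          ((o (n + 1)).le z x ↔ ∃ u ∈ U, (o n).le u x)) := by
  obtain ⟨f, hf⟩ :=
    exists_seq_frequently_eq (Finset (RegularOrbits Γ) × Finset (RegularOrbits Γ))
  choose next hstage hagree hreal using fun (n : ℕ) (s : {o // IsStage a n o}) =>
    s.2.exists_next (f n).1 (f n).2
  let s : ∀ n, {o // IsStage a n o} := Nat.rec ⟨o₀, ho₀⟩ fun n s => ⟨next n s, hstage n s⟩
  refine ⟨fun n => (s n).1, fun n => (s n).2, fun n => hagree n (s n), fun L U N => ?_⟩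
  obtain ⟨n, hn, hfn⟩ := hf (L, U) N
  have hz := hreal n (s n)
  rw [hfn] at hz
  exact ⟨n, hn, hz⟩

theorem IsStage.exists_invariant_limit {a : Γ} {o : ℕ → PartialOrder (RegularOrbits Γ)}
    (ho : ∀ n, IsStage a n (o n))
    (hagree : ∀ n x y, x.1 ≤ n → y.1 ≤ n → ((o (n + 1)).le x y ↔ (o n).le x y)) :
    ∃ _ : PartialOrder (RegularOrbits Γ), (∀ γ : Γ, Monotone fun x : RegularOrbits Γ => γ • x) ∧
      (∀ x y : RegularOrbits Γ, ∀ᶠ k : ℕ in atTop, x < a ^ k • y) ∧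
      ∀ n (x y : RegularOrbits Γ), x.1 ≤ n → y.1 ≤ n → (x ≤ y ↔ (o n).le x y) := by
  obtain ⟨o', ho'⟩ := exists_partialOrder_limit Sigma.fst o hagree
  refine ⟨o', fun γ x y hxy => ?_, fun x y => ?_, ho'⟩ <;>
    have hx : x.1 ≤ max x.1 y.1 := le_max_left _ _ <;>
    have hy : y.1 ≤ max x.1 y.1 := le_max_right _ _
  · exact (ho' _ (γ • x) (γ • y) hx hy).2 ((ho _).covariant.elim γ ((ho' _ x y hx hy).1 hxy))
  · refine ((ho (max x.1 y.1)).eventually_lt x y hx hy).mono fun k hk => ?_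
    rw [lt_iff_le_not_ge, ho' _ x (a ^ k • y) hx hy, ho' _ (a ^ k • y) x hy hx]
    exact ((o _).lt_iff_le_not_ge _ _).1 hk

theorem exists_invariant_partialOrder [Countable Γ] {M : Type*} [CommGroup M] [LinearOrder M]
    [IsOrderedMonoid M] [MulArchimedean M] (φ : Γ →* M) {a : Γ} (ha : 1 < φ a) :
    ∃ _ : PartialOrder (RegularOrbits Γ), (∀ γ : Γ, Monotone fun x : RegularOrbits Γ => γ • x) ∧
      (∀ x y : RegularOrbits Γ, ∀ᶠ k : ℕ in atTop, x < a ^ k • y) ∧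
      HasOnePointExtensions (RegularOrbits Γ) := by
  obtain ⟨o₀, ho₀⟩ := exists_isStage_zero φ ha
  obtain ⟨o, hstage, hagree, hreal⟩ := exists_isStage_seq ho₀
  obtain ⟨_, hmono, hunb, hle⟩ := IsStage.exists_invariant_limit hstage hagree
  let x₀ : RegularOrbits Γ := ⟨0, 1⟩
  refine ⟨_, hmono, hunb,
    .of_nonempty (fun A => ?_) (fun A => ?_) fun A L U hLA hUA hL hU hLU => ?_⟩
  · obtain ⟨k, hk⟩ := ((Finset.eventually_all A).2 fun y _ => hunb x₀ y).exists
    refine ⟨(a ^ k)⁻¹ • x₀, fun y hy => ?_⟩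
    have hstrict := (hmono (a ^ k)⁻¹).strictMono_of_injective (MulAction.injective _)
    simpa only [inv_smul_smul] using hstrict (hk y hy)
  · obtain ⟨k, hk⟩ := ((Finset.eventually_all A).2 fun y _ => hunb y x₀).exists
    exact ⟨a ^ k • x₀, hk⟩
  · obtain ⟨n, hn, hz⟩ := hreal L U (A.sup Sigma.fst)
    have hAn : ∀ x ∈ A, x.1 ≤ n := fun x hx => (Finset.le_sup hx).trans hn
    have hLn : ∀ l ∈ L, l.1 ≤ n := fun l hl => hAn l (hLA hl)
    have hUn : ∀ u ∈ U, u.1 ≤ n := fun u hu => hAn u (hUA hu)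
    obtain ⟨z, hzn, hz⟩ := hz ⟨hL, hU, hLn, hUn, fun l hl u hu => by
      have hlu := hLU l hl u hu
      rw [lt_iff_le_not_ge, hle n l u (hLn l hl) (hUn u hu), hle n u l (hUn u hu) (hLn l hl)] at hlu
      exact ((o n).lt_iff_le_not_ge _ _).2 hlu⟩
    refine ⟨z, fun hzA => by have := hAn z hzA; omega, fun x hx => ?_⟩
    have hxn := hAn x hx
    rw [hle (n + 1) x z (hxn.trans n.le_succ) hzn.le, hle (n + 1) z x hzn.le (hxn.trans n.le_succ),
      (hz x hxn).1, (hz x hxn).2]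
    exact ⟨exists_congr fun l => and_congr_right fun hl => (hle n x l hxn (hLn l hl)).symm,
      exists_congr fun u => and_congr_right fun hu => (hle n u x (hUn u hu) hxn).symm⟩

end InvariantOrder

section UnboundedTranslation

open Filter

/-- An unbounded translation of a poset: its powers move every point above every other one in the
end. -/
def IsUnboundedTranslation {P : Type*} [PartialOrder P] (g : P ≃o P) : Prop :=
  ∀ x y, ∀ᶠ k : ℕ in atTop, x < (g ^ k) y

variable {Γ P : Type*} [Group Γ] [PartialOrder P]

/-- A monotone group action, transported along an isomorphism of posets, as a homomorphism to the
automorphism group. -/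
def orderIsoAction {V : Type*} [PartialOrder V] [MulAction Γ V]
    (hV : ∀ γ : Γ, Monotone fun x : V => γ • x) (e : V ≃o P) : Γ →* (P ≃o P) where
  toFun γ := e.symm.trans <| .trans
    { toEquiv := MulAction.toPerm γ
      map_rel_iff' := fun {x y} => ⟨fun h => by simpa using hV γ⁻¹ h, fun h => hV γ h⟩ } e
  map_one' := by ext x; simp
  map_mul' γ δ := by ext x; simp [RelIso.mul_apply, mul_smul]

theorem exists_action_isUnboundedTranslation [Countable P] (hP : HasOnePointExtensions P)
    [Countable Γ] {M : Type*} [CommGroup M] [LinearOrder M] [IsOrderedMonoid M]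
    [MulArchimedean M] (φ : Γ →* M) {a : Γ} (ha : 1 < φ a) :
    ∃ ρ : Γ →* (P ≃o P), Function.Injective ρ ∧ IsUnboundedTranslation (ρ a) := by
  obtain ⟨_, hmono, hunb, hext⟩ := exists_invariant_partialOrder φ ha
  obtain ⟨e⟩ := hext.nonempty_orderIso hP
  refine ⟨orderIsoAction hmono e, (injective_iff_map_eq_one _).2 fun γ hγ => ?_, fun x y => ?_⟩
  · have hfix : e (γ • ⟨0, 1⟩) = e ⟨0, 1⟩ := by
      simpa [orderIsoAction] using DFunLike.congr_fun hγ (e ⟨0, 1⟩)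
    simpa [Sigma.smul_mk] using e.injective hfix
  · filter_upwards [hunb (e.symm x) (e.symm y)] with k hk
    rw [← map_pow]
    exact e.symm_apply_lt.1 hk

theorem HasOnePointExtensions.exists_isUnboundedTranslation [Countable P]
    (hP : HasOnePointExtensions P) :
    ∃ g u : P ≃o P, IsUnboundedTranslation g ∧ GenerateFreeGroup g u := by
  let φ : FreeGroup (Fin 2) →* Multiplicative ℤ := FreeGroup.lift ![.ofAdd 1, 1]
  obtain ⟨ρ, hinj, hρ⟩ := exists_action_isUnboundedTranslation hP φ (a := .of 0)
    (by simp only [φ, FreeGroup.lift_apply_of]; decide)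
  have hlift : FreeGroup.lift ![ρ (.of 0), ρ (.of 1)] = ρ := by
    ext i : 1
    fin_cases i <;> simp
  exact ⟨ρ (.of 0), ρ (.of 1), hρ, by rwa [GenerateFreeGroup, hlift]⟩

end UnboundedTranslation

section Encoding

open Filter

variable {P : Type*} [PartialOrder P]

theorem tendsto_orderAut_of_eventually_eq {ι : Type*} {l : Filter ι} {F : ι → (P ≃o P)}
    {f : P ≃o P} (h : ∀ x, ∀ᶠ i in l, F i x = f x) : Tendsto F l (𝓝 f) := by
  let _ : TopologicalSpace P := ⊥
  have : DiscreteTopology P := ⟨rfl⟩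
  have hind : IsInducing fun (g : P ≃o P) (x : P) => g x := ⟨rfl⟩
  exact hind.tendsto_nhds_iff.2 (tendsto_pi_nhds.2 fun x =>
    tendsto_nhds_of_eventually_eq (h x))

open scoped Classical in
/-- The part of the graph of `f` that lies over `B` in both coordinates. -/
noncomputable def graphWithin (f : P ≃o P) (B : Finset P) : Finset (P × P) :=
  {p ∈ B ×ˢ B | f p.1 = p.2}

theorem mem_graphWithin {f : P ≃o P} {B : Finset P} {p : P × P} :
    p ∈ graphWithin f B ↔ (p.1 ∈ B ∧ p.2 ∈ B) ∧ f p.1 = p.2 := by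
  simp only [graphWithin, Finset.mem_filter, Finset.mem_product]

theorem isPartialIso_graphWithin (f : P ≃o P) (B : Finset P) :
    IsPartialIso (graphWithin f B : Set (P × P)) := by
  intro p hp q hq
  rw [← (mem_graphWithin.1 hp).2, ← (mem_graphWithin.1 hq).2, f.le_iff_le]

theorem isLocallyConstant_graphWithin (B : Finset P) :
    IsLocallyConstant fun f : P ≃o P => graphWithin f B := by
  refine (IsLocallyConstant.iff_eventually_eq _).2 fun f => ?_
  have heval : ∀ᶠ f' in 𝓝 f, ∀ x ∈ B, f' x = f x :=
    (Finset.eventually_all B).2 fun x _ => (isOpen_orderAut_eval x (f x)).mem_nhds rfl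
  filter_upwards [heval] with f' hf'
  ext p
  simp only [mem_graphWithin]
  exact and_congr_right fun hp => by rw [hf' p.1 hp.1]

theorem exists_continuous_orderAut {Z : Type*} [TopologicalSpace Z]
    {S : ℕ → Z → Finset (P × P)} (hconst : ∀ n, IsLocallyConstant (S n))
    (hmono : ∀ z, Monotone fun n => S n z)
    (hS : ∀ z n, IsPartialIso (S n z : Set (P × P)))
    (hdom : ∀ z x, ∃ n y, (x, y) ∈ S n z) (hran : ∀ z y, ∃ n x, (x, y) ∈ S n z) :
    ∃ H : Z → (P ≃o P), Continuous H ∧ ∀ z n, ∀ p ∈ S n z, H z p.1 = p.2 := by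
  choose H hH using fun z => exists_orderIso_of_monotone (hmono z) (hS z) (hdom z) (hran z)
  refine ⟨H, continuous_orderAut_of_eval fun x y => ?_, hH⟩
  have hunion : {z | H z x = y} = ⋃ n, S n ⁻¹' {T | (x, y) ∈ T} := by
    ext z
    simp only [Set.mem_iUnion]
    refine ⟨fun hz => ?_, fun ⟨n, hn⟩ => hH z n _ hn⟩
    obtain ⟨n, y', hn⟩ := hdom z x
    obtain rfl : y' = y := (hH z n _ hn).symm.trans hz
    exact ⟨n, hn⟩
  rw [hunion]
  exact isOpen_iUnion fun n => hconst n _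

theorem IsPartialIso.exists_extension_union (hP : HasOnePointExtensions P)
    {S T : Finset (P × P)} (hS : IsPartialIso (S : Set (P × P)))
    (hT : IsPartialIso (T : Set (P × P))) {c c' : P} (hcc' : c < c')
    (hSc : ∀ p ∈ S, p.1 < c ∧ p.2 < c) (hcT : ∀ p ∈ T, c < p.1 ∧ c < p.2)
    (hTc' : ∀ p ∈ T, p.1 < c' ∧ p.2 < c') {a : P} (ha : a < c') :
    ∃ S' : Finset (P × P), IsPartialIso (S' : Set (P × P)) ∧ (∀ p ∈ S', p.1 < c' ∧ p.2 < c') ∧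
      S ⊆ S' ∧ T ⊆ S' ∧ (∃ y, (a, y) ∈ S') ∧ ∃ x, (x, a) ∈ S' := by
  classical
  have hunion : IsPartialIso ((S ∪ T : Finset (P × P)) : Set (P × P)) := by
    rw [Finset.coe_union]
    exact hS.union_of_lt hT fun p hp q hq =>
      ⟨(hSc p hp).1.trans (hcT q hq).1, (hSc p hp).2.trans (hcT q hq).2⟩
  have hlt : ∀ p ∈ S ∪ T, p.1 < c' ∧ p.2 < c' := fun p hp =>
    (Finset.mem_union.1 hp).elim
      (fun h => ⟨(hSc p h).1.trans hcc', (hSc p h).2.trans hcc'⟩) (hTc' p)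
  obtain ⟨S', hS', hS'lt, hsub, hdom, hran⟩ := hunion.exists_extension_lt hP hP hlt ha ha
  exact ⟨S', hS', hS'lt, Finset.union_subset_left hsub, Finset.union_subset_right hsub, hdom, hran⟩

/-- Each step depends only on the current partial isomorphism and the current block; this makes the
automorphism obtained in the limit depend continuously on the sequence of blocks. -/
theorem HasOnePointExtensions.exists_stacking (hP : HasOnePointExtensions P) {e c : ℕ → P}
    {B : ℕ → Finset P} (hec : ∀ n, e n < c (n + 1)) (hc : ∀ n, c n < c (n + 1))
    (hB : ∀ n, ∀ x ∈ B n, c n < x ∧ x < c (n + 1)) :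
    ∃ F : ℕ → Finset (P × P) → Finset (P × P) → Finset (P × P), ∀ T S : ℕ → Finset (P × P),
      (∀ n, IsPartialIso (T n : Set (P × P)) ∧ T n ⊆ B n ×ˢ B n) →
      S 0 = ∅ → (∀ n, S (n + 1) = F n (S n) (T n)) →
      ∀ n, IsPartialIso (S n : Set (P × P)) ∧ S n ⊆ S (n + 1) ∧ T n ⊆ S (n + 1) ∧
        (∃ y, (e n, y) ∈ S (n + 1)) ∧ ∃ x, (x, e n) ∈ S (n + 1) := by
  let State (n : ℕ) (S : Finset (P × P)) : Prop :=
    IsPartialIso (S : Set (P × P)) ∧ ∀ p ∈ S, p.1 < c n ∧ p.2 < c n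
  have hstep : ∀ n (S T : Finset (P × P)), State n S →
      IsPartialIso (T : Set (P × P)) ∧ T ⊆ B n ×ˢ B n → ∃ S', State (n + 1) S' ∧
        S ⊆ S' ∧ T ⊆ S' ∧ (∃ y, (e n, y) ∈ S') ∧ ∃ x, (x, e n) ∈ S' := by
    rintro n S T hS ⟨hT, hTB⟩
    have hTc : ∀ p ∈ T, (c n < p.1 ∧ p.1 < c (n + 1)) ∧ c n < p.2 ∧ p.2 < c (n + 1) := fun p hp =>
      have hpB := Finset.mem_product.1 (hTB hp)
      ⟨hB n _ hpB.1, hB n _ hpB.2⟩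
    obtain ⟨S', hS', hlt, hsub⟩ := hS.1.exists_extension_union hP hT (hc n) hS.2
      (fun p hp => ⟨(hTc p hp).1.1, (hTc p hp).2.1⟩) (fun p hp => ⟨(hTc p hp).1.2, (hTc p hp).2.2⟩)
      (hec n)
    exact ⟨S', ⟨hS', hlt⟩, hsub⟩
  choose! F hF hsub using hstep
  refine ⟨F, fun T S hT hS₀ hS n => ?_⟩
  have hState : ∀ n, State n (S n) := fun n => by
    induction n with
    | zero => simp [State, hS₀, IsPartialIso]
    | succ n ih => exact hS n ▸ hF n _ _ ih (hT n)
  exact ⟨(hState n).1, hS n ▸ hsub n _ _ (hState n) (hT n)⟩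

theorem HasOnePointExtensions.exists_continuous_gluing (hP : HasOnePointExtensions P)
    {e c : ℕ → P} {B : ℕ → Finset P} (he : Function.Surjective e) (hec : ∀ n, e n < c (n + 1))
    (hc : ∀ n, c n < c (n + 1)) (hB : ∀ n, ∀ x ∈ B n, c n < x ∧ x < c (n + 1)) :
    ∃ H : (ℕ → (P ≃o P)) → (P ≃o P), Continuous H ∧
      ∀ f n, ∀ x ∈ B n, f n x ∈ B n → H f x = f n x := by
  obtain ⟨F, hF⟩ := hP.exists_stacking hec hc hB
  let S (n : ℕ) (f : ℕ → (P ≃o P)) : Finset (P × P) :=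
    Nat.rec ∅ (fun n S => F n S (graphWithin (f n) (B n))) n
  have hS := fun f => hF (fun n => graphWithin (f n) (B n)) (S · f)
    (fun n => ⟨isPartialIso_graphWithin _ _, fun p hp =>
      Finset.mem_product.2 (mem_graphWithin.1 hp).1⟩) rfl fun _ => rfl
  have hconst : ∀ n, IsLocallyConstant (S n) := fun n => by
    induction n with
    | zero => exact .const ∅
    | succ n ih =>
      have hblock : IsLocallyConstant fun f : ℕ → (P ≃o P) => graphWithin (f n) (B n) :=
        (isLocallyConstant_graphWithin (B n)).comp_continuous (continuous_apply n)
      exact (ih.prodMk hblock).comp fun q => F n q.1 q.2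
  obtain ⟨H, hH, hHS⟩ := exists_continuous_orderAut hconst
    (fun f => monotone_nat_of_le_succ fun n => (hS f n).2.1) (fun f n => (hS f n).1)
    (fun f => he.forall.2 fun n => ⟨n + 1, (hS f n).2.2.2.1⟩)
    (fun f => he.forall.2 fun n => ⟨n + 1, (hS f n).2.2.2.2⟩)
  exact ⟨H, hH, fun f n x hx hfx =>
    hHS f (n + 1) (x, f n x) ((hS f n).2.2.1 (mem_graphWithin.2 ⟨⟨hx, hfx⟩, rfl⟩))⟩

theorem IsUnboundedTranslation.exists_blocks {g : P ≃o P} (hg : IsUnboundedTranslation g)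
    (hP : HasOnePointExtensions P) (B : ℕ → Finset P) :
    ∃ (c : ℕ → P) (k : ℕ → ℕ), (∀ n, c n < c (n + 1)) ∧
      ∀ n, ∀ x ∈ B n, x < c (n + 1) ∧ c n < (g ^ k n) x ∧ (g ^ k n) x < c (n + 1) := by
  classical
  obtain ⟨c₀⟩ := hP.nonempty
  choose k hk using fun (n : ℕ) (c : P) =>
    ((Finset.eventually_all (B n)).2 fun x _ => hg c x).exists
  choose next hnext using fun (n : ℕ) (c : P) =>
    hP.exists_forall_lt (insert c (B n ∪ (B n).image (g ^ k n c)))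
  let c : ℕ → P := Nat.rec c₀ next
  refine ⟨c, fun n => k n (c n), fun n => hnext n (c n) _ (by simp), fun n x hx => ?_⟩
  have himage : (g ^ k n (c n)) x ∈ (B n).image (g ^ k n (c n)) := Finset.mem_image_of_mem _ hx
  exact ⟨hnext n (c n) x (by simp [hx]), hk n (c n) x hx,
    hnext n (c n) _ (Finset.mem_insert_of_mem (Finset.mem_union_right _ himage))⟩

theorem IsUnboundedTranslation.encodesSequences [Countable P] {g : P ≃o P}
    (hg : IsUnboundedTranslation g) (hP : HasOnePointExtensions P) : EncodesSequences g := by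
  classical
  have := hP.nonempty
  obtain ⟨e, he⟩ := exists_surjective_nat P
  let B : ℕ → Finset P := fun n => (Finset.range (n + 1)).image e
  have hmemB : ∀ x, ∀ᶠ n in atTop, x ∈ B n := he.forall.2 fun j => by
    filter_upwards [eventually_ge_atTop j] with n hn
    exact Finset.mem_image_of_mem e (Finset.mem_range.2 (Nat.lt_succ_of_le hn))
  obtain ⟨c, k, hc, hB⟩ := hg.exists_blocks hP B
  obtain ⟨H, hHcont, hH⟩ := hP.exists_continuous_gluing (c := c)
    (B := fun n => (B n).image (g ^ k n)) he
    (fun n => (hB n _ (Finset.mem_image_of_mem e (Finset.self_mem_range_succ n))).1) hc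
    (fun n => Finset.forall_mem_image.2 fun x hx => (hB n x hx).2)
  let f (d : ℕ → (P ≃o P)) (n : ℕ) : P ≃o P := g ^ k n * d n.unpair.1 * (g ^ k n)⁻¹
  have hf : ∀ d n x, f d n ((g ^ k n) x) = (g ^ k n) (d n.unpair.1 x) := by
    simp [f, RelIso.mul_apply]
  refine ⟨fun d => H (f d), fun m i => -k (Nat.pair m i), hHcont.comp (by fun_prop),
    fun d m => tendsto_orderAut_of_eventually_eq fun x => ?_⟩
  have hpair : Tendsto (Nat.pair m) atTop atTop :=
    tendsto_atTop_mono (Nat.right_le_pair m) tendsto_id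
  filter_upwards [hpair.eventually (hmemB x), hpair.eventually (hmemB (d m x))] with i hx hdx
  set n := Nat.pair m i with hn
  have hfx : f d n ((g ^ k n) x) = (g ^ k n) (d m x) := by rw [hf, hn, Nat.unpair_pair]
  have hHx : H (f d) ((g ^ k n) x) = (g ^ k n) (d m x) := by
    rw [hH _ n _ (Finset.mem_image_of_mem _ hx) (hfx ▸ Finset.mem_image_of_mem _ hdx), hfx]
  rw [neg_neg, zpow_neg, zpow_natCast, RelIso.mul_apply, RelIso.mul_apply, hHx,
    RelIso.inv_apply_self]

end Encoding

section LZero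

open Filter TopologicalSpace

theorem eventually_natFloor_inv_sub_half_eq (n : ℕ) :
    ∀ᶠ t : ℝ in 𝓝 (n + 1 : ℝ)⁻¹, ⌊t⁻¹ - 1 / 2⌋₊ = n := by
  have hcont : ContinuousAt (fun t : ℝ => t⁻¹ - 1 / 2) (n + 1 : ℝ)⁻¹ :=
    (continuousAt_inv₀ (by positivity)).sub continuousAt_const
  have hIoo : Set.Ioo (n : ℝ) (n + 1) ∈ 𝓝 ((n + 1 : ℝ)⁻¹⁻¹ - 1 / 2) := by
    rw [inv_inv]
    exact Ioo_mem_nhds (by linarith) (by linarith)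
  filter_upwards [hcont hIoo] with t ht
  exact Nat.floor_eq_iff (n.cast_nonneg.trans ht.1.le) |>.2 ⟨ht.1.le, ht.2⟩

variable {X : Type*} [MeasurableSpace X] {μ : Measure X}

theorem exists_measurable_nat_approx [IsFiniteMeasure μ] [IsSeparable μ] :
    ∃ ψ : ℕ → X → ℕ, (∀ m, Measurable (ψ m)) ∧ ∀ φ : X → ℕ, Measurable φ →
      ∃ k : ℕ → ℕ, ∀ᵐ x ∂μ, ∀ᶠ i in atTop, ψ (k i) x = φ x := by
  have : Fact ((1 : ENNReal) ≤ 1) := ⟨le_rfl⟩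
  have : Fact ((1 : ENNReal) ≠ ⊤) := ⟨ENNReal.one_ne_top⟩
  -- Decode `φ` from the bounded function `(φ + 1)⁻¹`, approximated in the separable space `L¹`.
  let D : ℕ → Lp ℝ 1 μ := denseSeq (Lp ℝ 1 μ)
  refine ⟨fun m x => ⌊(D m x)⁻¹ - 1 / 2⌋₊, fun m => Nat.measurable_floor.comp
    ((Lp.stronglyMeasurable (D m)).measurable.inv.sub_const _), fun φ hφ => ?_⟩
  have hmem : MemLp (fun x => (φ x + 1 : ℝ)⁻¹) 1 μ :=
    .of_bound (by fun_prop) 1 <| .of_forall fun x => by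
      rw [Real.norm_of_nonneg (by positivity)]
      exact inv_le_one_of_one_le₀ (by linarith [(φ x).cast_nonneg (α := ℝ)])
  obtain ⟨F, hF, hlim⟩ := mem_closure_iff_seq_limit.1
    (denseRange_denseSeq (Lp ℝ 1 μ) (hmem.toLp _))
  choose j hj using hF
  obtain ⟨s, -, hs⟩ := (tendstoInMeasure_of_tendsto_Lp hlim).exists_seq_tendsto_ae
  refine ⟨j ∘ s, ?_⟩
  filter_upwards [hs, hmem.coeFn_toLp] with x hx hφx
  rw [hφx] at hx
  filter_upwards [hx.eventually (eventually_natFloor_inv_sub_half_eq (φ x))] with i hi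
  rw [← hi, ← hj]
  rfl

section Representatives

variable {Y : Type*} [TopologicalSpace Y]

theorem LZero.stronglyMeasurable_rep (f : LZero μ Y) : StronglyMeasurable f.rep :=
  AEEqFun.stronglyMeasurable (μ := μ) f

/-- The class in `L₀(X, μ; Y)` of an almost everywhere strongly measurable function. -/
noncomputable def LZero.mk (F : X → Y) (hF : AEStronglyMeasurable F μ) : LZero μ Y :=
  AEEqFun.mk F hF

theorem LZero.rep_mk (F : X → Y) (hF : AEStronglyMeasurable F μ) :
    (LZero.mk F hF).rep =ᵐ[μ] F :=
  AEEqFun.coeFn_mk F hF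

/-- The class in `L₀(X, μ; Y)` of the function `y ∘ φ`, where `φ` is measurable and the sequence `y`
lists its countably many values. -/
noncomputable def LZero.ofIndex (y : ℕ → Y) {φ : X → ℕ} (hφ : Measurable φ) : LZero μ Y :=
  LZero.mk (y ∘ φ) (continuous_of_discreteTopology.comp_stronglyMeasurable
    hφ.stronglyMeasurable).aestronglyMeasurable

theorem LZero.rep_ofIndex (y : ℕ → Y) {φ : X → ℕ} (hφ : Measurable φ) :
    (LZero.ofIndex (μ := μ) y hφ).rep =ᵐ[μ] y ∘ φ :=
  LZero.rep_mk _ _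

/-- The class in `L₀(X, μ; Y)` of the constant function `u`. -/
noncomputable def LZero.const (μ : Measure X) (u : Y) : LZero μ Y :=
  LZero.mk (fun _ => u) aestronglyMeasurable_const

theorem LZero.rep_const (u : Y) : (LZero.const μ u).rep =ᵐ[μ] fun _ => u :=
  LZero.rep_mk _ _

variable [IsProbabilityMeasure μ] [PolishSpace Y]

theorem LZero.tendsto_of_tendsto_ae {F : ℕ → LZero μ Y} {f : LZero μ Y}
    (h : ∀ᵐ x ∂μ, Tendsto (fun i => (F i).rep x) atTop (𝓝 (f.rep x))) :
    Tendsto F atTop (𝓝 f) := by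
  let _ := compatibleCompleteMetric Y
  have hmeas := tendstoInMeasure_iff_measureReal_dist.1 (tendstoInMeasure_of_tendsto_ae
    (fun i => (F i).stronglyMeasurable_rep.aestronglyMeasurable) h)
  refine tendsto_nhds.2 fun U hU hfU => ?_
  obtain ⟨δ, hδ, ε, hε, hsub⟩ := hU f hfU
  filter_upwards [(hmeas δ hδ).eventually (gt_mem_nhds hε)] with i hi
  suffices 1 < μ.real {x | dist ((F i).rep x) (f.rep x) < δ} + ε from
    hsub (sub_lt_iff_lt_add.2 this)
  calc 1 = μ.real ({x | dist ((F i).rep x) (f.rep x) < δ} ∪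
        {x | δ ≤ dist ((F i).rep x) (f.rep x)}) := by
        rw [← probReal_univ (μ := μ), ← Set.ofPred_or]
        simp only [lt_or_ge, Set.ofPred_true]
    _ ≤ _ := measureReal_union_le _ _
    _ < _ := by gcongr

theorem LZero.separableSpace [IsSeparable μ] [Nonempty Y] : SeparableSpace (LZero μ Y) := by
  obtain ⟨ψ, hψ, happrox⟩ := exists_measurable_nat_approx (μ := μ)
  let D (m : ℕ) : LZero μ Y := LZero.ofIndex (denseSeq Y) (hψ m)
  have hD {φ : X → ℕ} (hφ : Measurable φ) :
      LZero.ofIndex (denseSeq Y) hφ ∈ closure (Set.range D) := by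
    obtain ⟨k, hk⟩ := happrox φ hφ
    refine mem_closure_of_tendsto (f := D ∘ k) (LZero.tendsto_of_tendsto_ae ?_)
      (.of_forall fun i => ⟨k i, rfl⟩)
    filter_upwards [hk, LZero.rep_ofIndex (denseSeq Y) hφ,
      ae_all_iff.2 fun i => LZero.rep_ofIndex (denseSeq Y) (hψ (k i))] with x hx hφx hψx
    refine tendsto_const_nhds.congr' ?_
    filter_upwards [hx] with i hi
    exact hφx.trans ((congrArg (denseSeq Y) hi).symm.trans (hψx i).symm)
  refine .of_denseRange D fun f => isClosed_closure.closure_subset ?_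
  let _ := compatibleCompleteMetric Y
  borelize Y
  have hφ (N : ℕ) : Measurable fun x => SimpleFunc.nearestPtInd (denseSeq Y) N (f.rep x) :=
    (SimpleFunc.measurable _).comp f.stronglyMeasurable_rep.measurable
  refine mem_closure_of_tendsto (LZero.tendsto_of_tendsto_ae ?_) (.of_forall fun N => hD (hφ N))
  filter_upwards [ae_all_iff.2 fun N => LZero.rep_ofIndex (denseSeq Y) (hφ N)] with x hx
  exact (SimpleFunc.tendsto_nearestPt (denseRange_denseSeq Y (f.rep x))).congr fun N => (hx N).symm

end Representatives

section Group

variable {G : Type*} [Group G] [TopologicalSpace G] [IsTopologicalGroup G]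

theorem LZero.rep_lift (g h : LZero μ G) (w : FreeGroup (Fin 2)) :
    (FreeGroup.lift ![g, h] w).rep =ᵐ[μ] fun x => FreeGroup.lift ![g.rep x, h.rep x] w := by
  induction w using FreeGroup.induction_on with
  | C1 =>
    filter_upwards [AEEqFun.coeFn_one (μ := μ) (β := G)] with x hx
    rw [map_one, map_one]
    exact hx
  | of i => fin_cases i <;> simp
  | inv_of i ih =>
    filter_upwards [ih, AEEqFun.coeFn_inv (FreeGroup.lift ![g, h] (.of i))] with x hx hinv
    rw [map_inv, map_inv, ← hx]
    exact hinv
  | mul v w hv hw =>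
    filter_upwards [hv, hw, AEEqFun.coeFn_mul (FreeGroup.lift ![g, h] v)
      (FreeGroup.lift ![g, h] w)] with x hvx hwx hmul
    rw [map_mul, map_mul, ← hvx, ← hwx]
    exact hmul

theorem LZero.generateFreeGroup_of_ae [NeZero μ] {g h : LZero μ G}
    (hfree : ∀ᵐ x ∂μ, GenerateFreeGroup (g.rep x) (h.rep x)) : GenerateFreeGroup g h := by
  refine (injective_iff_map_eq_one _).2 fun w hw => ?_
  have hone : (1 : LZero μ G).rep =ᵐ[μ] 1 := AEEqFun.coeFn_one
  have hrep := LZero.rep_lift g h w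
  rw [hw] at hrep
  obtain ⟨x, hx, hx1, hxw⟩ := (hfree.and (hone.and hrep)).exists
  exact (injective_iff_map_eq_one _).1 hx w (hxw.symm.trans hx1)

theorem LZero.rep_const_zpow_conj (g : G) (h : LZero μ G) (l : ℤ) :
    (LZero.const μ g ^ l * h * LZero.const μ g ^ (-l)).rep =ᵐ[μ]
      fun x => g ^ l * h.rep x * g ^ (-l) := by
  let w : FreeGroup (Fin 2) := .of 0 ^ l * .of 1 * .of 0 ^ (-l)
  filter_upwards [LZero.rep_lift (LZero.const μ g) h w, LZero.rep_const g] with x hx hg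
  rw [hg] at hx
  simpa [w] using hx

variable [IsProbabilityMeasure μ] [PolishSpace G]

theorem EncodesSequences.exists_lZero_encoding {g : G} (hg : EncodesSequences g)
    (d : ℕ → LZero μ G) :
    ∃ h : LZero μ G, (∀ m, d m ∈ closure (cyclicConjugates (LZero.const μ g) h)) ∧
      ∀ᵐ x ∂μ, ∀ m, (d m).rep x ∈ closure (cyclicConjugates g (h.rep x)) := by
  obtain ⟨H, k, hH, hk⟩ := hg
  have hmeas : AEStronglyMeasurable (fun x => H fun m => (d m).rep x) μ := by
    borelize G
    exact (hH.measurable.comp (measurable_pi_lambda _ fun m =>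
      (d m).stronglyMeasurable_rep.measurable)).stronglyMeasurable.aestronglyMeasurable
  have hrep := LZero.rep_mk _ hmeas
  refine ⟨LZero.mk _ hmeas, fun m => mem_closure_cyclicConjugates (k := k m)
    (LZero.tendsto_of_tendsto_ae ?_), ?_⟩
  · filter_upwards [hrep, ae_all_iff.2 fun i => LZero.rep_const_zpow_conj g (LZero.mk _ hmeas)
      (k m i)] with x hx hconj
    simp only [hconj, hx]
    exact hk (fun m => (d m).rep x) m
  · filter_upwards [hrep] with x hx m
    rw [hx]
    exact mem_closure_cyclicConjugates (hk (fun m => (d m).rep x) m)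

theorem EncodesSequences.exists_lZero_cyclicallyGenerates [IsSeparable μ] {g u : G}
    (hg : EncodesSequences g) (hfree : GenerateFreeGroup g u) :
    ∃ g' h : LZero μ G, CyclicallyGenerates g' h ∧ GenerateFreeGroup g' h := by
  have := LZero.separableSpace (μ := μ) (Y := G)
  let d (m : ℕ) : LZero μ G := m.casesOn (LZero.const μ u) (denseSeq (LZero μ G))
  obtain ⟨h, hh, hrep⟩ := hg.exists_lZero_encoding d
  refine ⟨LZero.const μ g, h, ?_, LZero.generateFreeGroup_of_ae ?_⟩
  · exact cyclicallyGenerates_of_denseRange (denseRange_denseSeq (LZero μ G)) fun m => hh (m + 1)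
  · filter_upwards [hrep, LZero.rep_const g, LZero.rep_const u] with x hx hg hu
    rw [hg]
    exact hfree.of_mem_closure (hu ▸ hx 0)

end Group

end LZero

theorem mainTheorem7_general {P : Type*} [PartialOrder P] [Countable P] (hP : IsRandomPoset P)
    (ι : Type*) [Countable ι] [Nonempty ι] {X : Type*} [MeasurableSpace X] (μ : Measure X)
    [IsProbabilityMeasure μ] [IsSeparable μ] :
    (∃ g h : ι → (P ≃o P), CyclicallyGenerates g h ∧ GenerateFreeGroup g h) ∧
    (∃ g h : LZero μ (P ≃o P), CyclicallyGenerates g h ∧ GenerateFreeGroup g h) := by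
  have hext := hP.hasOnePointExtensions
  obtain ⟨g, u, hunbounded, hfree⟩ := hext.exists_isUnboundedTranslation
  have hencodes : EncodesSequences g := hunbounded.encodesSequences hext
  exact ⟨hencodes.exists_pi_cyclicallyGenerates hfree ι,
    hencodes.exists_lZero_cyclicallyGenerates hfree⟩

theorem mainTheorem7 {P : Type*} [PartialOrder P] [Countable P] (hP : IsRandomPoset P)
    {X : Type*} [MeasurableSpace X] [StandardBorelSpace X]
    (μ : Measure X) [IsProbabilityMeasure μ] [NullSingletonClass μ] :
    (∀ n : ℕ, 1 ≤ n → HasCyclicallyDenseConjClass (Fin n → (P ≃o P))) ∧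
    HasCyclicallyDenseConjClass (LZero μ (P ≃o P)) ∧
    (∀ n : ℕ, 1 ≤ n → ∃ g h : Fin n → (P ≃o P),
      CyclicallyGenerates g h ∧ GenerateFreeGroup g h) ∧
    (∃ g h : LZero μ (P ≃o P), CyclicallyGenerates g h ∧ GenerateFreeGroup g h) := by
  have hpi (n : ℕ) (hn : 1 ≤ n) :=
    have : NeZero n := ⟨Nat.one_le_iff_ne_zero.1 hn⟩
    (mainTheorem7_general hP (Fin n) μ).1
  have hL₀ := (mainTheorem7_general hP Unit μ).2
  exact ⟨fun n hn => (hpi n hn).imp fun _ => .imp fun _ => And.left,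
    hL₀.imp fun _ => .imp fun _ => And.left, hpi, hL₀⟩
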